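/- **Setting.** Let $U\subseteq\mathbb R^4$ be open with coordinates $x^0,\dots,x^3$ (a coordinate domain of spacetime). Let $g_{\mu\nu}$ be a smooth Lorentzian metric on $U$ of signature $(+,-,-,-)$, with inverse $g^{\mu\nu}$ and Levi-Civita connection $\Gamma^\kappa{}_{\mu\nu}$. Let $\epsilon_{ab}=\epsilon^{ab}=\epsilon_{\dot a\dot b}=\epsilon^{\dot a\dot b}=\begin{pmatrix}0&1\\-1&0\end{pmatrix}$. Let $\sigma^\alpha{}_{a\dot b}$ ($\alpha=0,1,2,3$) be smooth Pauli matrices for $g$ on $U$: at each point they are a basis of the real space of Hermitian $2\times2$ matrices, and $$\sigma^\alpha{}_{a\dot b}\sigma^{\beta c\dot b}+\sigma^\beta{}_{a\dot b}\sigma^{\alpha c\dot b}=2g^{\alpha\beta}\delta_a{}^c,\qquad \sigma^{\alpha a\dot b}:=\epsilon^{ac}\sigma^\alpha{}_{c\dot d}\,\epsilon^{\dot b\dot d}.$$ Let $\xi^a:U\to\mathbb C^2$ be a smooth spinor field. Put $$\nabla_\mu\xi^a=\partial_\mu\xi^a+\Gamma^a{}_{\mu b}\xi^b,\quad \nabla_\mu\bar\xi^{\dot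 a}=\partial_\mu\bar\xi^{\dot a}+\overline{\Gamma^a{}_{\mu b}}\,\bar\xi^{\dot b},\quad \Gamma^a{}_{\mu b}=\tfrac14\sigma_\alpha{}^{a\dot c}\bigl(\partial_\mu\sigma^\alpha{}_{b\dot c}+\Gamma^\alpha{}_{\mu\beta}\sigma^\beta{}_{b\dot c}\bigr),$$ where $\sigma_\alpha=g_{\alpha\beta}\sigma^\beta$, and for compact $K\subseteq U$ consider the massless neutrino (Weyl) action $$S_K(g,\sigma,\xi)=2i\int_K\bigl(\xi^a\sigma^\mu{}_{a\dot b}\nabla_\mu\bar\xi^{\dot b}-(\nabla_\mu\xi^a)\sigma^\mu{}_{a\dot b}\bar\xi^{\dot b}\bigr)\sqrt{|\det g|}\,dx^0dx^1dx^2dx^3 .$$ **Variations.** A *symmetric variation* supported in $K$ is a family $(g_t,\sigma_t)$, $|t|<r$, smooth in $(t,x)$ on $(-r,r)\times U$, with $g_t$ symmetric, $(g_0,\sigma_0)=(g,\sigma)$, $(g_t,\sigma_t)=(g,\sigma)$ on $U\setminus K$, and, with $\delta:=\frac{d}{dt}\big|_{t=0}$, $$\delta\sigma^\alpha=-\tfrac12\,g^{\alpha\beta}(\delta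 g_{\beta\gamma})\,\sigma^\gamma .$$ Only this first-order behaviour is prescribed: the Clifford relation for $(g_t,\sigma_t)$ is allowed but not required at $t\neq0$. The spinor $\xi$ is kept fixed. An *energy–momentum tensor* of the action at $(g,\sigma,\xi)$ is a continuous symmetric tensor field $E^{\mu\nu}$ (complex-valued components allowed) on $U$ such that, for every compact $K\subseteq U$ and every symmetric variation supported in $K$, the integrand of $S_K(g_t,\sigma_t,\xi)$ is integrable over $K$ for all $t$ near $0$, the derivative $\delta S_K$ exists, and $$\delta S_K=\int_K E^{\mu\nu}\,\delta g_{\mu\nu}\,\sqrt{|\det g|}\,dx^0dx^1dx^2dx^3 .$$ **Lemma.** (1) With $\nabla^\mu=g^{\mu\kappa}\nabla_\kappa$, $$E^{\mu\nu}=\frac i2\Bigl[\sigma^\nu{}_{a\dot b}\bigl(\bar\xi^{\dot b}\nabla^\mu\xi^a-\xi^a\nabla^\mu\bar\xi^{\dot b}\bigr)+\sigma^\mu{}_{a\dot b}\bigl(\bar\xi^{\dot b}\nabla^\nu\xi^a-\xi^a\nabla^\nu\bar\xi^{\dot b}\bigr)\Bigr]+i\Bigl(\xi^a\sigma^\eta{}_{a\dot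 b}(\nabla_\eta\bar\xi^{\dot b})g^{\mu\nu}-(\nabla_\eta\xi^a)\sigma^\eta{}_{a\dot b}\bar\xi^{\dot b}g^{\mu\nu}\Bigr)$$ is an energy–momentum tensor of the action at $(g,\sigma,\xi)$. (2) It is the only one. (3) For every symmetric variation supported in a compact $K\subseteq U$, the variations $\delta\nabla_\eta\xi^a$ and $\delta\nabla_\eta\bar\xi^{\dot b}$ exist on $U$, and the terms of $\delta S_K$ that contain them cancel: the following integrand is integrable over $K$ and $$2i\int_K\bigl(\xi^a\sigma^\eta{}_{a\dot b}\,(\delta\nabla_\eta\bar\xi^{\dot b})-(\delta\nabla_\eta\xi^a)\,\sigma^\eta{}_{a\dot b}\,\bar\xi^{\dot b}\bigr)\sqrt{|\det g|}\,dx^0dx^1dx^2dx^3=0 .$$ -/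

import Mathlib

open MeasureTheory Set Filter Topology
open scoped ContDiff Matrix ComplexConjugate

noncomputable section

namespace Neutrino

/-- Coordinate space with coordinates `x⁰, x¹, x², x³`. -/
abbrev Coord : Type := Fin 4 → ℝ

/-- Components `g_{μν}(x)` of a covariant metric. -/
abbrev MetricField : Type := Coord → Matrix (Fin 4) (Fin 4) ℝ

/-- Components `σ^α_{a ḃ}(x)`: for every `α` a complex `2 × 2` matrix, first index `a`, second
index `ḃ`. -/
abbrev PauliField : Type := Coord → Fin 4 → Matrix (Fin 2) (Fin 2) ℂ

/-- Components `ξ^a(x)`. -/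
abbrev SpinorField : Type := Coord → Fin 2 → ℂ

/-- The partial derivative `∂f / ∂x^μ`. -/
def partialD {F : Type*} [NormedAddCommGroup F] [NormedSpace ℝ F]
    (μ : Fin 4) (f : Coord → F) (x : Coord) : F :=
  fderiv ℝ f x (Pi.single μ 1)

/-! ### Metric, Levi-Civita connection -/

/-- The Minkowski matrix `diag(1, -1, -1, -1)`. -/
def minkowski : Matrix (Fin 4) (Fin 4) ℝ := Matrix.diagonal ![1, -1, -1, -1]

/-- Lorentzian inner product of signature `(+,-,-,-)`: a symmetric matrix that is congruent to the
Minkowski matrix. -/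
def IsLorentzian (G : Matrix (Fin 4) (Fin 4) ℝ) : Prop :=
  G.IsSymm ∧ ∃ P : Matrix (Fin 4) (Fin 4) ℝ, IsUnit P.det ∧ Pᵀ * G * P = minkowski

/-- `√|det g|` at `x`. -/
def volDensity (g : MetricField) (x : Coord) : ℝ := Real.sqrt |(g x).det|

/-- The Christoffel symbols `Γ^κ_{μν}` of the Levi-Civita connection of `g`;
`g^{κλ}` is the inverse matrix of `g_{κλ}`. -/
def christoffel (g : MetricField) (x : Coord) (κ μ ν : Fin 4) : ℝ :=
  (1 / 2) * ∑ l, (g x)⁻¹ κ l *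
    (partialD μ (fun y => g y l ν) x + partialD ν (fun y => g y l μ) x
      - partialD l (fun y => g y μ ν) x)

/-! ### Spinor formalism -/

/-- The metric spinor `ε^{ab} = ε_{ab} = ε^{ȧḃ} = ε_{ȧḃ}`. -/
def epsSpinor : Matrix (Fin 2) (Fin 2) ℂ := !![0, 1; -1, 0]

/-- Raising both spinor indices: `σ^{a ḃ} = ε^{ac} σ_{c ḋ} ε^{ḃ ḋ}`. -/
def raiseSpinor (s : Matrix (Fin 2) (Fin 2) ℂ) (a b : Fin 2) : ℂ :=
  ∑ c, ∑ d, epsSpinor a c * s c d * epsSpinor b d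

/-- `s^α` are Pauli matrices for the covariant inner product `G`: a basis of the real
vector space of Hermitian `2 × 2` matrices, with
`σ^α_{aḃ} σ^{β cḃ} + σ^β_{aḃ} σ^{α cḃ} = 2 g^{αβ} δ_a^c`. -/
def IsPauli (G : Matrix (Fin 4) (Fin 4) ℝ) (s : Fin 4 → Matrix (Fin 2) (Fin 2) ℂ) : Prop :=
  LinearIndependent ℝ s ∧
  Submodule.span ℝ (range s) = selfAdjoint.submodule ℝ (Matrix (Fin 2) (Fin 2) ℂ) ∧
  ∀ α β a c, ∑ b, (s α a b * raiseSpinor (s β) c b + s β a b * raiseSpinor (s α) c b)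
    = 2 * ((G⁻¹ α β : ℝ) : ℂ) * (if a = c then 1 else 0)

/-- `σ_α^{a ċ} = g_{αβ} σ^{β a ċ}`. -/
def pauliLow (g : MetricField) (σ : PauliField) (x : Coord) (α : Fin 4) (a c : Fin 2) : ℂ :=
  ∑ β, ((g x α β : ℝ) : ℂ) * raiseSpinor (σ x β) a c

/-- The spinor connection coefficients of the Levi-Civita connection,
`Γ^a_{μb} = ¼ σ_α^{aċ} (∂_μ σ^α_{bċ} + Γ^α_{μβ} σ^β_{bċ})`. -/
def spinConn (g : MetricField) (σ : PauliField) (x : Coord) (a : Fin 2) (μ : Fin 4)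
    (b : Fin 2) : ℂ :=
  (1 / 4) * ∑ α, ∑ c, pauliLow g σ x α a c *
    (partialD μ (fun y => σ y α b c) x
      + ∑ β, ((christoffel g x α μ β : ℝ) : ℂ) * σ x β b c)

/-- `∇_μ ξ^a = ∂_μ ξ^a + Γ^a_{μb} ξ^b`. -/
def nablaSpinor (g : MetricField) (σ : PauliField) (ξ : SpinorField) (x : Coord)
    (μ : Fin 4) (a : Fin 2) : ℂ :=
  partialD μ (fun y => ξ y a) x + ∑ b, spinConn g σ x a μ b * ξ x b

/-- `∇_μ ξ̄^ȧ = ∂_μ ξ̄^ȧ + Γ̄^ȧ_{μḃ} ξ̄^ḃ`, with `Γ̄` the complex conjugate of `Γ`. -/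
def nablaSpinorBar (g : MetricField) (σ : PauliField) (ξ : SpinorField) (x : Coord)
    (μ : Fin 4) (a : Fin 2) : ℂ :=
  partialD μ (fun y => conj (ξ y a)) x + ∑ b, conj (spinConn g σ x a μ b) * conj (ξ x b)

/-! ### The action -/

/-- The expression `ψ^a s^μ_{aḃ} D̄_μ^ḃ - D_μ^a s^μ_{aḃ} ψ̄^ḃ`. -/
def weylForm (s : Fin 4 → Matrix (Fin 2) (Fin 2) ℂ) (ψ : Fin 2 → ℂ)
    (D Dbar : Fin 4 → Fin 2 → ℂ) : ℂ :=
  ∑ μ, ∑ a, ∑ b, (ψ a * s μ a b * Dbar μ b - D μ a * s μ a b * conj (ψ b))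

/-- The integrand (with respect to `dx⁰dx¹dx²dx³`) of the massless neutrino action. -/
def neutrinoDensity (g : MetricField) (σ : PauliField) (ξ : SpinorField) (x : Coord) : ℂ :=
  weylForm (σ x) (ξ x) (nablaSpinor g σ ξ x) (nablaSpinorBar g σ ξ x) * (volDensity g x : ℂ)

/-- The massless neutrino action over a region `K`,
`2i ∫_K (ξ^a σ^μ_{aḃ} ∇_μ ξ̄^ḃ - (∇_μ ξ^a) σ^μ_{aḃ} ξ̄^ḃ) √|det g| dx⁰dx¹dx²dx³`. -/
def neutrinoAction (K : Set Coord) (g : MetricField) (σ : PauliField) (ξ : SpinorField) : ℂ :=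
  2 * Complex.I * ∫ x in K, neutrinoDensity g σ ξ x

/-! ### Backgrounds and variations -/

/-- A smooth Lorentzian metric, smooth Pauli matrices for it, and a smooth spinor field on `U`. -/
structure IsBackground (U : Set Coord) (g : MetricField) (σ : PauliField) (ξ : SpinorField) :
    Prop where
  lorentzian : ∀ x ∈ U, IsLorentzian (g x)
  pauli : ∀ x ∈ U, IsPauli (g x) (σ x)
  smooth_metric : ∀ μ ν, ContDiffOn ℝ ∞ (fun x => g x μ ν) U
  smooth_pauli : ∀ α a b, ContDiffOn ℝ ∞ (fun x => σ x α a b) U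
  smooth_spinor : ∀ a, ContDiffOn ℝ ∞ (fun x => ξ x a) U

/-- The first variation `δg_{μν}` of a one-parameter family of metrics at parameter `0`. -/
def deltaMetric (gt : ℝ → MetricField) (x : Coord) (μ ν : Fin 4) : ℝ :=
  deriv (fun t => gt t x μ ν) 0

/-- A variation of `(g, σ)` on `U`, supported in the compact set `K ⊆ U`: a smooth
one-parameter family `(gt, σt)` of symmetric matrices and of Pauli matrices through `(g, σ)`, where
the Pauli matrices vary symmetrically to first order,
`δσ^α = -½ g^{αβ} (δg_{βγ}) σ^γ`.

Only the first-order behaviour in `t` is prescribed. Hence the families that satisfy the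
Clifford relation for every `t` are included, and so is the straight line
`(g + t h, σ - (t/2) g⁻¹ h σ)`. -/
structure IsSymmVariation (U : Set Coord) (g : MetricField) (σ : PauliField)
    (K : Set Coord) (r : ℝ) (gt : ℝ → MetricField) (σt : ℝ → PauliField) : Prop where
  compact : IsCompact K
  subset : K ⊆ U
  pos : 0 < r
  smooth_metric : ∀ μ ν,
    ContDiffOn ℝ ∞ (fun p : ℝ × Coord => gt p.1 p.2 μ ν) (Ioo (-r) r ×ˢ U)
  smooth_pauli : ∀ α a b,
    ContDiffOn ℝ ∞ (fun p : ℝ × Coord => σt p.1 p.2 α a b) (Ioo (-r) r ×ˢ U)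
  symm : ∀ t ∈ Ioo (-r) r, ∀ x ∈ U, (gt t x).IsSymm
  metric_zero : ∀ x ∈ U, gt 0 x = g x
  pauli_zero : ∀ x ∈ U, σt 0 x = σ x
  metric_off : ∀ t ∈ Ioo (-r) r, ∀ x ∈ U \ K, gt t x = g x
  pauli_off : ∀ t ∈ Ioo (-r) r, ∀ x ∈ U \ K, σt t x = σ x
  pauli_deriv : ∀ x ∈ U, ∀ α a b,
    HasDerivAt (fun t => σt t x α a b)
      (-(1 / 2) * ∑ β, ∑ γ, (((g x)⁻¹ α β * deltaMetric gt x β γ : ℝ) : ℂ) * σ x γ a b) 0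

/-- `E^{μν}` is an energy-momentum tensor of the neutrino action at `(g, σ, ξ)`: a continuous
symmetric tensor with `δS = ∫ E^{μν} δg_{μν} √|det g|` for all compactly supported variations of the
metric with symmetric variation of the Pauli matrices, the spinor being kept fixed. -/
def IsEnergyMomentumTensor (U : Set Coord) (g : MetricField) (σ : PauliField) (ξ : SpinorField)
    (E : Coord → Fin 4 → Fin 4 → ℂ) : Prop :=
  (∀ μ ν, ContinuousOn (fun x => E x μ ν) U) ∧
  (∀ x ∈ U, ∀ μ ν, E x μ ν = E x ν μ) ∧
  ∀ (K : Set Coord) (r : ℝ) (gt : ℝ → MetricField) (σt : ℝ → PauliField),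
    IsSymmVariation U g σ K r gt σt →
      (∀ᶠ t in 𝓝 (0 : ℝ), IntegrableOn (neutrinoDensity (gt t) (σt t) ξ) K) ∧
      HasDerivAt (fun t => neutrinoAction K (gt t) (σt t) ξ)
        (∫ x in K, (∑ μ, ∑ ν, E x μ ν * (deltaMetric gt x μ ν : ℂ)) * (volDensity g x : ℂ)) 0

/-! ### The explicit tensor -/

/-- `∇^μ ξ^a = g^{μκ} ∇_κ ξ^a`. -/
def nablaSpinorUp (g : MetricField) (σ : PauliField) (ξ : SpinorField) (x : Coord)
    (μ : Fin 4) (a : Fin 2) : ℂ :=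
  ∑ κ, (((g x)⁻¹ μ κ : ℝ) : ℂ) * nablaSpinor g σ ξ x κ a

/-- `∇^μ ξ̄^ȧ = g^{μκ} ∇_κ ξ̄^ȧ`. -/
def nablaSpinorBarUp (g : MetricField) (σ : PauliField) (ξ : SpinorField) (x : Coord)
    (μ : Fin 4) (a : Fin 2) : ℂ :=
  ∑ κ, (((g x)⁻¹ μ κ : ℝ) : ℂ) * nablaSpinorBar g σ ξ x κ a

/-- `E^{μν} = (i/2) [σ^ν_{aḃ} (ξ̄^ḃ ∇^μ ξ^a - ξ^a ∇^μ ξ̄^ḃ) + σ^μ_{aḃ} (ξ̄^ḃ ∇^ν ξ^a - ξ^a ∇^ν ξ̄^ḃ)]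
  + i (ξ^a σ^η_{aḃ} (∇_η ξ̄^ḃ) g^{μν} - (∇_η ξ^a) σ^η_{aḃ} ξ̄^ḃ g^{μν})`. -/
def energyMomentum (g : MetricField) (σ : PauliField) (ξ : SpinorField) (x : Coord)
    (μ ν : Fin 4) : ℂ :=
  Complex.I / 2 * ∑ a, ∑ b,
      (σ x ν a b * (conj (ξ x b) * nablaSpinorUp g σ ξ x μ a
          - ξ x a * nablaSpinorBarUp g σ ξ x μ b)
        + σ x μ a b * (conj (ξ x b) * nablaSpinorUp g σ ξ x ν a
          - ξ x a * nablaSpinorBarUp g σ ξ x ν b))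
    + Complex.I * ∑ η, ∑ a, ∑ b,
      (ξ x a * σ x η a b * nablaSpinorBar g σ ξ x η b * (((g x)⁻¹ μ ν : ℝ) : ℂ)
        - nablaSpinor g σ ξ x η a * σ x η a b * conj (ξ x b) * (((g x)⁻¹ μ ν : ℝ) : ℂ))

/-! ### The terms with the variation of the spinor covariant derivative -/

/-- `δ∇_μ ξ^a`, with the spinor kept fixed. -/
def deltaNabla (gt : ℝ → MetricField) (σt : ℝ → PauliField) (ξ : SpinorField) (x : Coord)
    (μ : Fin 4) (a : Fin 2) : ℂ :=
  deriv (fun t => nablaSpinor (gt t) (σt t) ξ x μ a) 0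

/-- `δ∇_μ ξ̄^ȧ`, with the spinor kept fixed. -/
def deltaNablaBar (gt : ℝ → MetricField) (σt : ℝ → PauliField) (ξ : SpinorField) (x : Coord)
    (μ : Fin 4) (a : Fin 2) : ℂ :=
  deriv (fun t => nablaSpinorBar (gt t) (σt t) ξ x μ a) 0

/-- The integrand of the part of `δS` that comes from `δ∇ξ` and `δ∇ξ̄`:
`(ξ^a σ^η_{aḃ} (δ∇_η ξ̄^ḃ) - (δ∇_η ξ^a) σ^η_{aḃ} ξ̄^ḃ) √|det g|`. -/
def connectionDensity (g : MetricField) (σ : PauliField) (ξ : SpinorField)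
    (gt : ℝ → MetricField) (σt : ℝ → PauliField) (x : Coord) : ℂ :=
  weylForm (σ x) (ξ x) (deltaNabla gt σt ξ x) (deltaNablaBar gt σt ξ x) * (volDensity g x : ℂ)

end Neutrino

end

/-!
The Weyl form sees the spinor connection only through the anti-Hermitian part of the `2 × 2` matrix
`∑_μ (Γ_μ)ᵀ σ^μ` (`weylForm_eq_zero`). So the terms with `δ∇ξ` and `δ∇ξ̄` cancel, pointwise and before
any integration, once `∑_μ (δΓ_μ)ᵀ σ^μ` is known to be Hermitian.

To see this, lower the index of `∂_μ σ^α + Γ^α_{μβ} σ^β` instead of that of `σ_α`: the coefficients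
become polynomial in `g`, `σ` and their first derivatives, with Christoffel symbols of the first
kind and no inverse metric (`spinConn_eq_firstKind`), which makes the variation easy. The symmetry
condition reads `g_{αβ} δσ^β = -½ δg_{αγ} σ^γ`; this equation and its partial derivatives remove all
terms in `∂σ` and `∂δσ`. What remains are sums of `Q · A^γ adj(B^β) C^μ` with real coefficients `Q`,
symmetric either in the indices of the last two factors, where the polarized determinant
`adj(A) B + adj(B) A` is a real scalar for Hermitian `A`, `B`, or in the indices of the two outer
factors, where taking adjoints only exchanges them. Both are Hermitian
(`isHermitian_connection_variation`).

The integrand of the action is smooth in `(t, x)` near `{0} × K`, so the action may be differentiated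
under the integral sign (`hasDerivAt_setIntegral_of_contDiffAt`). The product rule leaves the terms
with `δσ` and with `δ√|det g|`, and these are the stated tensor contracted with `δg`
(`sum_energyMomentum_mul`). For uniqueness, the straight-line variations
`(g + t φ S, σ - (t/2) φ g⁻¹ S σ)` with a bump function `φ` and a constant symmetric matrix `S` are
admissible, and the fundamental lemma of the calculus of variations applies
(`IsEnergyMomentumTensor.eqOn`).
-/

namespace Neutrino

/-! ### One-parameter families of fields -/

section Families

variable {F : Type*} [NormedAddCommGroup F] [NormedSpace ℝ F]

theorem partialD_congr {f g : Coord → F} {x : Coord} (h : f =ᶠ[𝓝 x] g) (μ : Fin 4) :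
    partialD μ f x = partialD μ g x := by
  rw [partialD, partialD, h.fderiv_eq]

theorem partialD_slice {f : ℝ × Coord → F} {p : ℝ × Coord} (hf : DifferentiableAt ℝ f p)
    (μ : Fin 4) :
    partialD μ (fun y => f (p.1, y)) p.2 = fderiv ℝ f p (0, Pi.single μ 1) := by
  have h : HasFDerivAt (fun y => f (p.1, y))
      ((fderiv ℝ f p).comp (ContinuousLinearMap.inr ℝ ℝ Coord)) p.2 :=
    HasFDerivAt.comp p.2 (f := fun y => (p.1, y)) hf.hasFDerivAt (hasFDerivAt_prodMk_right p.1 p.2)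
  rw [partialD, h.fderiv]
  simp

theorem hasDerivAt_slice {f : ℝ × Coord → F} {p : ℝ × Coord} (hf : DifferentiableAt ℝ f p) :
    HasDerivAt (fun t => f (t, p.2)) (fderiv ℝ f p (1, 0)) p.1 := by
  have h : HasFDerivAt (fun t => f (t, p.2))
      ((fderiv ℝ f p).comp (ContinuousLinearMap.inl ℝ ℝ Coord)) p.1 :=
    HasFDerivAt.comp p.1 (f := fun t => (t, p.2)) hf.hasFDerivAt (hasFDerivAt_prodMk_left p.1 p.2)
  simpa using h.hasDerivAt

theorem eventually_differentiableAt {f : ℝ × Coord → F} {p : ℝ × Coord}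
    (hf : ContDiffAt ℝ 1 f p) : ∀ᶠ q in 𝓝 p, DifferentiableAt ℝ f q :=
  (hf.eventually (by simp)).mono fun _ hq => hq.differentiableAt (by simp)

theorem contDiffAt_partialD {f : ℝ × Coord → F} {p : ℝ × Coord} (hf : ContDiffAt ℝ ∞ f p)
    (μ : Fin 4) : ContDiffAt ℝ ∞ (fun q : ℝ × Coord => partialD μ (fun y => f (q.1, y)) q.2) p := by
  have h : ContDiffAt ℝ ∞ (fun q => fderiv ℝ f q (0, Pi.single μ 1)) p :=
    (hf.fderiv_right (m := ∞) (by simp)).clm_apply contDiffAt_const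
  refine h.congr_of_eventuallyEq ?_
  filter_upwards [eventually_differentiableAt (hf.of_le (by simp))] with q hq
  exact partialD_slice hq μ

theorem tendsto_prodMk_zero (x : Coord) : Tendsto (fun t : ℝ => (t, x)) (𝓝 0) (𝓝 ((0 : ℝ), x)) :=
  (Continuous.prodMk_left x).tendsto 0

theorem tendsto_zero_prodMk (x : Coord) :
    Tendsto (fun y : Coord => ((0 : ℝ), y)) (𝓝 x) (𝓝 ((0 : ℝ), x)) :=
  (Continuous.prodMk_right (0 : ℝ)).tendsto x

/-- The first variation of a smooth family is differentiable in the space variable. -/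
theorem differentiableAt_deriv_slice {f : ℝ × Coord → F} {x : Coord}
    (hf : ContDiffAt ℝ 2 f (0, x)) :
    DifferentiableAt ℝ (fun y => deriv (fun t => f (t, y)) 0) x := by
  have h2 : DifferentiableAt ℝ (fderiv ℝ f) (0, x) :=
    (hf.fderiv_right (m := 1) (by norm_num)).differentiableAt (by simp)
  have h3 : DifferentiableAt ℝ (fun y : Coord => fderiv ℝ f (0, y) (1, 0)) x := by
    have : DifferentiableAt ℝ (fun y : Coord => fderiv ℝ f (0, y)) x :=
      DifferentiableAt.comp x (f := fun y : Coord => ((0 : ℝ), y)) h2 (by fun_prop)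
    exact this.clm_apply (differentiableAt_const _)
  refine h3.congr_of_eventuallyEq ?_
  filter_upwards [(tendsto_zero_prodMk x).eventually
    (eventually_differentiableAt (hf.of_le (by norm_num)))] with y hy
  exact (hasDerivAt_slice hy).deriv

/-- The first variation commutes with the partial derivatives. -/
theorem hasDerivAt_partialD {f : ℝ × Coord → F} {x : Coord}
    (hf : ContDiffAt ℝ 2 f (0, x)) (μ : Fin 4) :
    HasDerivAt (fun t => partialD μ (fun y => f (t, y)) x)
      (partialD μ (fun y => deriv (fun t => f (t, y)) 0) x) 0 := by
  have hev := eventually_differentiableAt (hf.of_le (by norm_num : (1 : ℕ∞ω) ≤ 2))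
  have h2 : HasFDerivAt (fderiv ℝ f) (fderiv ℝ (fderiv ℝ f) (0, x)) (0, x) :=
    ((hf.fderiv_right (m := 1) (by norm_num)).differentiableAt (by simp)).hasFDerivAt
  have hx : HasFDerivAt (fun y : Coord => fderiv ℝ f (0, y) (1, 0))
      (((fderiv ℝ (fderiv ℝ f) (0, x)).comp (ContinuousLinearMap.inr ℝ ℝ Coord)).flip (1, 0)) x := by
    have := HasFDerivAt.comp x (f := fun y : Coord => ((0 : ℝ), y)) h2
      (hasFDerivAt_prodMk_right (0 : ℝ) x)
    simpa using this.clm_apply (hasFDerivAt_const ((1 : ℝ), (0 : Coord)) x)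
  have ht : HasDerivAt (fun t : ℝ => fderiv ℝ f (t, x) (0, Pi.single μ 1))
      (fderiv ℝ (fderiv ℝ f) (0, x) (1, 0) (0, Pi.single μ 1)) 0 := by
    have := HasFDerivAt.comp (0 : ℝ) (f := fun t : ℝ => (t, x)) h2
      (hasFDerivAt_prodMk_left (0 : ℝ) x)
    have := (this.clm_apply (hasFDerivAt_const ((0 : ℝ), (Pi.single μ 1 : Coord)) 0)).hasDerivAt
    simpa using this
  have e1 : partialD μ (fun y => deriv (fun t => f (t, y)) 0) x
      = fderiv ℝ (fderiv ℝ f) (0, x) (1, 0) (0, Pi.single μ 1) := by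
    have : (fun y => deriv (fun t => f (t, y)) 0) =ᶠ[𝓝 x]
        fun y : Coord => fderiv ℝ f (0, y) (1, 0) := by
      filter_upwards [(tendsto_zero_prodMk x).eventually hev] with y hy
      exact (hasDerivAt_slice hy).deriv
    rw [partialD, this.fderiv_eq, hx.fderiv]
    simpa using (hf.isSymmSndFDerivAt (by simp)).eq (0, Pi.single μ 1) (1, 0)
  rw [e1]
  refine ht.congr_of_eventuallyEq ?_
  filter_upwards [(tendsto_prodMk_zero x).eventually hev] with t ht
  exact partialD_slice ht μ

/-- Differentiation under the integral sign over a compact set, for an integrand that is `C¹` in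
the parameter and the variable jointly. -/
theorem hasDerivAt_setIntegral_of_contDiffAt {f : ℝ × Coord → F} {K : Set Coord}
    (hK : IsCompact K) (hf : ∀ x ∈ K, ContDiffAt ℝ 1 f (0, x)) :
    (∀ᶠ t in 𝓝 (0 : ℝ), IntegrableOn (fun x => f (t, x)) K) ∧
    HasDerivAt (fun t => ∫ x in K, f (t, x)) (∫ x in K, deriv (fun t => f (t, x)) 0) 0 := by
  set V : Set (ℝ × Coord) := {p | ContDiffAt ℝ 1 f p} with hV
  have hVo : IsOpen V := isOpen_iff_mem_nhds.2 fun p hp => ContDiffAt.eventually hp (by simp)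
  obtain ⟨u, v, hu, -, h0u, hKv, huv⟩ := generalized_tube_lemma (isCompact_singleton (x := (0 : ℝ)))
    hK hVo (by rintro ⟨t, x⟩ ⟨rfl, hx⟩; exact hf x hx)
  obtain ⟨ε, hε, hεu⟩ := Metric.nhds_basis_closedBall.mem_iff.1
    (hu.mem_nhds (h0u (mem_singleton _)))
  have hVK : Metric.closedBall (0 : ℝ) ε ×ˢ K ⊆ V := fun p hp => huv ⟨hεu hp.1, hKv hp.2⟩
  have hdiff : ∀ p ∈ V, DifferentiableAt ℝ f p := fun p hp =>
    ContDiffAt.differentiableAt (n := 1) hp (by simp)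
  have hcont : ContinuousOn (fun p => fderiv ℝ f p (1, 0)) V := fun p hp => by
    have h : ContDiffAt ℝ 1 f p := hp
    exact ((h.fderiv_right (m := 0) (by simp)).continuousAt.clm_apply
      continuousAt_const).continuousWithinAt
  have hslice : ∀ t ∈ Metric.closedBall (0 : ℝ) ε, ContinuousOn (fun x => f (t, x)) K :=
    fun t ht x hx => ((hdiff _ (hVK (mk_mem_prod ht hx))).continuousAt.comp
      (f := fun x : Coord => (t, x)) (by fun_prop)).continuousWithinAt
  have hint : ∀ t ∈ Metric.closedBall (0 : ℝ) ε, IntegrableOn (fun x => f (t, x)) K :=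
    fun t ht => (hslice t ht).integrableOn_compact hK
  have hnhds : Metric.closedBall (0 : ℝ) ε ∈ 𝓝 (0 : ℝ) := Metric.closedBall_mem_nhds _ hε
  obtain ⟨C, hC⟩ := (((isCompact_closedBall (0 : ℝ) ε).prod hK).exists_bound_of_continuousOn
    (hcont.mono hVK))
  have h0 : (0 : ℝ) ∈ Metric.closedBall (0 : ℝ) ε := mem_of_mem_nhds hnhds
  refine ⟨by filter_upwards [hnhds] with t ht using hint t ht, ?_⟩
  have hmeas : MeasurableSet K := hK.measurableSet
  have key := (hasDerivAt_integral_of_dominated_loc_of_deriv_le (μ := volume.restrict K)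
    (F := fun t x => f (t, x)) (F' := fun t x => fderiv ℝ f (t, x) (1, 0)) (x₀ := (0 : ℝ))
    (bound := fun _ => C) hnhds
    (by filter_upwards [hnhds] with t ht using (hint t ht).aestronglyMeasurable)
    (hint 0 h0)
    (ContinuousOn.aestronglyMeasurable_of_isCompact
      (hcont.comp (f := fun x : Coord => ((0 : ℝ), x)) (by fun_prop)
        fun x hx => hVK (mk_mem_prod h0 hx)) hK hmeas)
    ((ae_restrict_iff' hmeas).2 (Eventually.of_forall fun x hx t ht => hC _ (mk_mem_prod ht hx)))
    (integrableOn_const hK.measure_lt_top.ne)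
    ((ae_restrict_iff' hmeas).2 (Eventually.of_forall fun x hx t ht =>
      hasDerivAt_slice (hdiff _ (hVK (mk_mem_prod ht hx)))))).2
  refine key.congr_deriv (setIntegral_congr_fun hmeas fun x hx => ?_)
  exact (hasDerivAt_slice (hdiff _ (hVK (mk_mem_prod h0 hx)))).deriv.symm

/-- Jacobi's formula. -/
theorem hasDerivAt_det {n : Type*} [Fintype n] [DecidableEq n] {A : ℝ → Matrix n n ℝ}
    {A' : Matrix n n ℝ} {t : ℝ} (h : ∀ i j, HasDerivAt (fun s => A s i j) (A' i j) t) :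
    HasDerivAt (fun s => (A s).det) (((A t).adjugate * A').trace) t := by
  have h1 : HasDerivAt (fun s => (A s).det)
      (∑ τ : Equiv.Perm n, (Equiv.Perm.sign τ : ℤ) •
        ∑ i, (∏ j ∈ Finset.univ.erase i, A t (τ j) j) * A' (τ i) i) t := by
    simp only [Matrix.det_apply]
    refine HasDerivAt.fun_sum fun τ _ => HasDerivAt.const_smul _ ?_
    simpa using HasDerivAt.fun_finsetProd (u := Finset.univ) fun i _ => h (τ i) i
  refine h1.congr_deriv ?_
  have h2 : ∀ i, ((A t).adjugate * A') i i = ((A t).updateCol i fun k => A' k i).det := fun i => by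
    rw [← Matrix.cramer_apply, Matrix.cramer_eq_adjugate_mulVec]
    rfl
  simp only [Matrix.trace, Matrix.diag_apply, h2, Matrix.det_apply, Finset.smul_sum]
  rw [Finset.sum_comm]
  refine Finset.sum_congr rfl fun i _ => Finset.sum_congr rfl fun τ _ => ?_
  rw [← Finset.mul_prod_erase _ _ (Finset.mem_univ i), mul_comm]
  simp only [Matrix.updateCol_self]
  congr 2
  exact Finset.prod_congr rfl fun j hj => by rw [Matrix.updateCol_ne (Finset.ne_of_mem_erase hj)]

end Families

/-! ### Two-by-two Hermitian matrices and the cancellation -/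

/-- The adjugate of a `2 × 2` matrix, written as `tr A - A` so that it is visibly linear. In
spinor indices it is the transpose of `ε A εᵀ`. -/
def adjugateTwo : Matrix (Fin 2) (Fin 2) ℂ →ₗ[ℝ] Matrix (Fin 2) (Fin 2) ℂ where
  toFun A := A.trace • 1 - A
  map_add' A B := by rw [Matrix.trace_add, add_smul]; abel
  map_smul' r A := by
    rw [Matrix.trace_smul, smul_assoc, RingHom.id_apply, smul_sub]

theorem adjugateTwo_apply (A : Matrix (Fin 2) (Fin 2) ℂ) : adjugateTwo A = A.trace • 1 - A := rfl

theorem raiseSpinor_eq_adjugateTwo (A : Matrix (Fin 2) (Fin 2) ℂ) (a c : Fin 2) :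
    raiseSpinor A a c = adjugateTwo A c a := by
  fin_cases a <;> fin_cases c <;>
    simp [raiseSpinor, epsSpinor, adjugateTwo_apply, Matrix.trace, Fin.sum_univ_two]

theorem isHermitian_adjugateTwo {A : Matrix (Fin 2) (Fin 2) ℂ} (hA : A.IsHermitian) :
    (adjugateTwo A).IsHermitian := by
  have h : star A.trace = A.trace := by rw [← Matrix.trace_conjTranspose, hA.eq]
  rw [adjugateTwo_apply, Matrix.IsHermitian, Matrix.conjTranspose_sub, Matrix.conjTranspose_smul,
    h, hA.eq, Matrix.conjTranspose_one]

/-- The polarized identity `adj(A) A = det A`: for Hermitian matrices the result is a real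
scalar. -/
theorem adjugateTwo_mul_add {A B : Matrix (Fin 2) (Fin 2) ℂ} (hA : A.IsHermitian)
    (hB : B.IsHermitian) :
    ∃ r : ℝ, adjugateTwo A * B + adjugateTwo B * A = r • (1 : Matrix (Fin 2) (Fin 2) ℂ) := by
  have hz : star (A.trace * B.trace - (A * B).trace) = A.trace * B.trace - (A * B).trace := by
    rw [star_sub, star_mul, ← Matrix.trace_conjTranspose, ← Matrix.trace_conjTranspose,
      ← Matrix.trace_conjTranspose, Matrix.conjTranspose_mul, hA.eq, hB.eq, mul_comm,
      Matrix.trace_mul_comm]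
  obtain ⟨r, hr⟩ := Complex.conj_eq_iff_real.1 hz
  refine ⟨r, ?_⟩
  have : adjugateTwo A * B + adjugateTwo B * A = (A.trace * B.trace - (A * B).trace) • 1 := by
    ext i j
    fin_cases i <;> fin_cases j <;>
      simp [adjugateTwo_apply, Matrix.trace, Matrix.mul_apply, Fin.sum_univ_two] <;> ring
  rw [this, hr]
  ext i j
  simp

theorem IsHermitian.real_smul {A : Matrix (Fin 2) (Fin 2) ℂ} (hA : A.IsHermitian) (r : ℝ) :
    (r • A).IsHermitian := by
  rw [Matrix.IsHermitian, Matrix.conjTranspose_smul, hA.eq, star_trivial]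

theorem IsHermitian.sum {ι : Type*} {s : Finset ι} {A : ι → Matrix (Fin 2) (Fin 2) ℂ}
    (hA : ∀ i ∈ s, (A i).IsHermitian) : (∑ i ∈ s, A i).IsHermitian := by
  rw [Matrix.IsHermitian, Matrix.conjTranspose_sum]
  exact Finset.sum_congr rfl hA

variable {ι : Type*} [Fintype ι]

/-- Symmetrizing in the last two factors replaces them by the real scalars of
`adjugateTwo_mul_add`. -/
theorem isHermitian_sum_mul_adjugateTwo_mul_right {s τ : ι → Matrix (Fin 2) (Fin 2) ℂ}
    (hs : ∀ i, (s i).IsHermitian) (hτ : ∀ i, (τ i).IsHermitian) {Q : ι → ι → ι → ℝ}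
    (hQ : ∀ i j k, Q i j k = Q i k j) :
    (∑ k, ∑ j, ∑ i, Q i j k • (τ i * adjugateTwo (s j) * s k)).IsHermitian := by
  set S := ∑ k, ∑ j, ∑ i, Q i j k • (τ i * adjugateTwo (s j) * s k) with hS
  have hswap : S = ∑ k, ∑ j, ∑ i, Q i j k • (τ i * (adjugateTwo (s k) * s j)) := by
    rw [hS, Finset.sum_comm]
    refine Finset.sum_congr rfl fun k _ => Finset.sum_congr rfl fun j _ =>
      Finset.sum_congr rfl fun i _ => ?_
    rw [hQ, mul_assoc]
  have h2 : (2 : ℝ) • S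
      = ∑ k, ∑ j, ∑ i, Q i j k • (τ i * (adjugateTwo (s j) * s k + adjugateTwo (s k) * s j)) := by
    simp only [mul_add, smul_add, Finset.sum_add_distrib]
    rw [← hswap, two_smul]
    simp only [hS, mul_assoc]
  have h3 : ((2 : ℝ) • S).IsHermitian := by
    rw [h2]
    refine IsHermitian.sum fun k _ => IsHermitian.sum fun j _ => IsHermitian.sum fun i _ => ?_
    obtain ⟨r, hr⟩ := adjugateTwo_mul_add (hs j) (hs k)
    rw [hr, mul_smul_comm, mul_one]
    exact IsHermitian.real_smul (IsHermitian.real_smul (hτ i) _) _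
  simpa using IsHermitian.real_smul h3 (1 / 2)

/-- Taking adjoints exchanges the two outer factors, in whose indices the coefficients are
symmetric. -/
theorem isHermitian_sum_mul_adjugateTwo_mul_mid {s τ : ι → Matrix (Fin 2) (Fin 2) ℂ}
    (hs : ∀ i, (s i).IsHermitian) (hτ : ∀ i, (τ i).IsHermitian) {Q : ι → ι → ι → ℝ}
    (hQ : ∀ i j k, Q i j k = Q k j i) :
    (∑ k, ∑ j, ∑ i, Q i j k • (s i * adjugateTwo (τ j) * s k)).IsHermitian := by
  have e : ∀ A : ι → ι → ι → Matrix (Fin 2) (Fin 2) ℂ,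
      ∑ k, ∑ j, ∑ i, A i j k = ∑ k, ∑ j, ∑ i, A k j i := fun A => by
    rw [Finset.sum_comm]
    rw [Finset.sum_congr rfl fun j _ => Finset.sum_comm, Finset.sum_comm]
  rw [Matrix.IsHermitian]
  conv_rhs => rw [e]
  simp only [Matrix.conjTranspose_sum, Matrix.conjTranspose_smul, Matrix.conjTranspose_mul,
    (hs _).eq, (isHermitian_adjugateTwo (hτ _)).eq, star_trivial, mul_assoc]
  refine Finset.sum_congr rfl fun k _ => Finset.sum_congr rfl fun j _ =>
      Finset.sum_congr rfl fun i _ => ?_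
  rw [hQ]

/-- The Christoffel combination `½ (∂_μ g_{βγ} + ∂_γ g_{βμ} - ∂_β g_{μγ})` of an array
`D μ β γ`, which stands for `∂_μ g_{βγ}`. -/
noncomputable def firstKind (D : ι → ι → ι → ℝ) (β μ γ : ι) : ℝ :=
  1 / 2 * (D μ β γ + D γ β μ - D β μ γ)

/-- The algebraic core of the cancellation. The matrix is `4 ∑_μ (δΓ_μ)ᵀ σ^μ`, with `s`, `τ`,
`g`, `h` for `σ`, `δσ`, `g`, `δg` and `ds`, `dτ`, `dg`, `dh` for their partial derivatives. The
symmetry condition `hR` on `τ` and its derivative `hdR` remove all terms with `ds` and `dτ`, and what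
is left has the index symmetries that make it Hermitian. -/
theorem isHermitian_connection_variation {s τ : ι → Matrix (Fin 2) (Fin 2) ℂ}
    {ds dτ : ι → ι → Matrix (Fin 2) (Fin 2) ℂ} {g h : ι → ι → ℝ} {dg dh : ι → ι → ι → ℝ}
    (hs : ∀ i, (s i).IsHermitian) (hτ : ∀ i, (τ i).IsHermitian)
    (hg : ∀ i j, g i j = g j i) (hh : ∀ i j, h i j = h j i)
    (hdg : ∀ k i j, dg k i j = dg k j i) (hdh : ∀ k i j, dh k i j = dh k j i)
    (hR : ∀ α, ∑ β, g α β • τ β = -(1 / 2 : ℝ) • ∑ γ, h α γ • s γ)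
    (hdR : ∀ μ α, ∑ β, (dg μ α β • τ β + g α β • dτ μ β)
      = -(1 / 2 : ℝ) • ∑ γ, (dh μ α γ • s γ + h α γ • ds μ γ)) :
    (∑ μ, (∑ β, ((∑ α, (h α β • ds μ α + g α β • dτ μ α)
          + ∑ γ, (firstKind dh β μ γ • s γ + firstKind dg β μ γ • τ γ)) * adjugateTwo (s β)
        + (∑ α, g α β • ds μ α + ∑ γ, firstKind dg β μ γ • s γ) * adjugateTwo (τ β)))
      * s μ).IsHermitian := by
  -- `hdR` eliminates `dτ` and leaves half of the term `h ds`
  have h1 : ∀ μ β, ∑ α, (h α β • ds μ α + g α β • dτ μ α)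
        + ∑ γ, (firstKind dh β μ γ • s γ + firstKind dg β μ γ • τ γ)
      = ∑ γ, ((1 / 2 : ℝ) • h γ β • ds μ γ
        + ((1 / 2 * dh γ β μ) • s γ + (-(1 / 2) * dh β μ γ) • s γ
        + (1 / 2 * (-dg μ β γ + dg γ β μ - dg β μ γ)) • τ γ)) := fun μ β => by
    have e1 : ∑ α, g α β • dτ μ α
        = ∑ γ, (-(1 / 2 : ℝ) • (dh μ β γ • s γ + h γ β • ds μ γ) - dg μ β γ • τ γ) := by
      have := hdR μ β
      rw [Finset.sum_add_distrib, ← eq_sub_iff_add_eq'] at this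
      simp only [hg _ β, hh _ β]
      rw [this, Finset.sum_sub_distrib, Finset.smul_sum]
    rw [Finset.sum_add_distrib, e1, ← Finset.sum_add_distrib, ← Finset.sum_add_distrib]
    refine Finset.sum_congr rfl fun γ _ => ?_
    simp only [firstKind]
    module
  -- `hR` turns `g ds adj(τ)` into the negative of that half
  have h2 : ∀ μ, ∑ β, (∑ α, g α β • ds μ α) * adjugateTwo (τ β)
      = - ∑ β, (∑ γ, (1 / 2 : ℝ) • h γ β • ds μ γ) * adjugateTwo (s β) := fun μ => by
    simp only [Finset.sum_mul]
    rw [Finset.sum_comm]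
    conv_rhs => rw [Finset.sum_comm]
    rw [← Finset.sum_neg_distrib]
    refine Finset.sum_congr rfl fun α _ => ?_
    have := congrArg (fun X => ds μ α * adjugateTwo X) (hR α)
    simp only [map_sum, map_smul, Finset.mul_sum, Finset.smul_sum, mul_smul_comm] at this
    simp only [smul_mul_assoc]
    rw [this, ← Finset.sum_neg_distrib]
    refine Finset.sum_congr rfl fun β _ => ?_
    module
  have h3 : ∀ μ, ∑ β, ((∑ α, (h α β • ds μ α + g α β • dτ μ α)
          + ∑ γ, (firstKind dh β μ γ • s γ + firstKind dg β μ γ • τ γ)) * adjugateTwo (s β)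
        + (∑ α, g α β • ds μ α + ∑ γ, firstKind dg β μ γ • s γ) * adjugateTwo (τ β))
      = ∑ β, ∑ γ, ((1 / 2 * dh γ β μ) • (s γ * adjugateTwo (s β))
        + (-(1 / 2) * dh β μ γ) • (s γ * adjugateTwo (s β))
        + (1 / 2 * (-dg μ β γ + dg γ β μ - dg β μ γ)) • (τ γ * adjugateTwo (s β))
        + firstKind dg β μ γ • (s γ * adjugateTwo (τ β))) := fun μ => by
    simp only [h1]
    simp only [add_mul, Finset.sum_add_distrib, h2]
    simp only [Finset.sum_mul, smul_mul_assoc]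
    abel
  simp only [h3]
  simp only [Finset.sum_mul, add_mul, smul_mul_assoc, Finset.sum_add_distrib]
  refine Matrix.IsHermitian.add (Matrix.IsHermitian.add (Matrix.IsHermitian.add ?_ ?_) ?_) ?_
  · exact isHermitian_sum_mul_adjugateTwo_mul_right (Q := fun γ β μ => 1 / 2 * dh γ β μ) hs hs
      fun i j k => by rw [hdh]
  · exact isHermitian_sum_mul_adjugateTwo_mul_mid (Q := fun γ β μ => -(1 / 2) * dh β μ γ) hs hs
      fun i j k => by rw [hdh]
  · exact isHermitian_sum_mul_adjugateTwo_mul_right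
      (Q := fun γ β μ => 1 / 2 * (-dg μ β γ + dg γ β μ - dg β μ γ)) hs hτ
      fun i j k => by rw [hdg i j k, hdg j k i, hdg k j i]; ring
  · exact isHermitian_sum_mul_adjugateTwo_mul_mid (Q := fun γ β μ => firstKind dg β μ γ) hs hτ
      fun i j k => by rw [firstKind, firstKind, hdg j i k]; ring

/-- Only the anti-Hermitian part of `∑_μ Γ_μᵀ s^μ` enters the Weyl form. -/
theorem weylForm_eq_zero {s : Fin 4 → Matrix (Fin 2) (Fin 2) ℂ} (hs : ∀ μ, (s μ).IsHermitian)
    {N : Fin 4 → Matrix (Fin 2) (Fin 2) ℂ} (hN : (∑ μ, N μ * s μ).IsHermitian) (ψ : Fin 2 → ℂ) :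
    weylForm s ψ (fun μ a => ∑ b, N μ b a * ψ b)
      (fun μ a => ∑ b, conj (N μ b a) * conj (ψ b)) = 0 := by
  have hM : ∀ a c, ∑ μ, ∑ b, N μ a b * s μ b c = ∑ μ, ∑ b, s μ a b * conj (N μ c b) := fun a c => by
    have := congrFun (congrFun hN.eq a) c
    rw [Matrix.conjTranspose_apply] at this
    simp only [Matrix.sum_apply, Matrix.mul_apply] at this
    rw [← this, star_sum]
    refine Finset.sum_congr rfl fun μ _ => ?_
    rw [star_sum]
    refine Finset.sum_congr rfl fun b _ => ?_
    rw [star_mul, (hs μ).apply]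
    rfl
  have key : weylForm s ψ (fun μ a => ∑ b, N μ b a * ψ b)
      (fun μ a => ∑ b, conj (N μ b a) * conj (ψ b))
      = ∑ a, ∑ c, ψ a * conj (ψ c) * (∑ μ, ∑ b, s μ a b * conj (N μ c b)
        - ∑ μ, ∑ b, N μ a b * s μ b c) := by
    simp only [weylForm, Fin.sum_univ_two, mul_sub, Finset.mul_sum, ← Finset.sum_sub_distrib,
      ← Finset.sum_add_distrib]
    refine Finset.sum_congr rfl fun μ _ => ?_
    ring
  rw [key]
  simp only [hM, sub_self, mul_zero, Finset.sum_const_zero]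

/-! ### The variation of the spinor connection -/

theorem IsLorentzian.det_ne_zero {G : Matrix (Fin 4) (Fin 4) ℝ} (h : IsLorentzian G) :
    G.det ≠ 0 := by
  obtain ⟨-, P, -, hP⟩ := h
  intro h0
  have := congrArg Matrix.det hP
  rw [Matrix.det_mul, Matrix.det_mul, h0, minkowski, Matrix.det_diagonal] at this
  simp [Fin.prod_univ_four] at this

theorem IsLorentzian.inv_apply_comm {G : Matrix (Fin 4) (Fin 4) ℝ} (h : IsLorentzian G)
    (i j : Fin 4) : G⁻¹ i j = G⁻¹ j i := by
  have : (G⁻¹)ᵀ = G⁻¹ := by rw [Matrix.transpose_nonsing_inv, h.1.eq]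
  exact congrFun (congrFun this j) i

theorem IsPauli.isHermitian {G : Matrix (Fin 4) (Fin 4) ℝ} {s : Fin 4 → Matrix (Fin 2) (Fin 2) ℂ}
    (h : IsPauli G s) (α : Fin 4) : (s α).IsHermitian := by
  have : s α ∈ selfAdjoint.submodule ℝ (Matrix (Fin 2) (Fin 2) ℂ) :=
    h.2.1 ▸ Submodule.subset_span (mem_range_self α)
  exact this

/-- The array `∂_k g_{ij}`. -/
noncomputable def partialMetric (g : MetricField) (x : Coord) (k i j : Fin 4) : ℝ :=
  partialD k (fun y => g y i j) x

theorem partialMetric_symm {g : MetricField} {x : Coord} (h : ∀ᶠ y in 𝓝 x, (g y).IsSymm)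
    (k i j : Fin 4) : partialMetric g x k i j = partialMetric g x k j i := by
  have : (fun y => g y i j) =ᶠ[𝓝 x] fun y => g y j i := by
    filter_upwards [h] with y hy using hy.apply j i
  exact partialD_congr this k

theorem sum_metric_mul_christoffel {g : MetricField} {x : Coord} (hs : (g x).IsSymm)
    (hdet : (g x).det ≠ 0) (β μ γ : Fin 4) :
    ∑ α, g x α β * christoffel g x α μ γ = firstKind (partialMetric g x) β μ γ := by
  have h1 : ∀ α, christoffel g x α μ γ
      = ((g x)⁻¹ *ᵥ fun l => firstKind (partialMetric g x) l μ γ) α := fun α => by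
    simp only [christoffel, Matrix.mulVec, dotProduct, firstKind, partialMetric, Finset.mul_sum]
    refine Finset.sum_congr rfl fun l _ => ?_
    ring
  have h2 : (g x) *ᵥ ((g x)⁻¹ *ᵥ fun l => firstKind (partialMetric g x) l μ γ)
      = fun l => firstKind (partialMetric g x) l μ γ := by
    rw [Matrix.mulVec_mulVec, Matrix.mul_nonsing_inv _ (isUnit_iff_ne_zero.2 hdet),
      Matrix.one_mulVec]
  rw [← congrFun h2 β]
  simp only [h1]
  rw [Matrix.mulVec, dotProduct]
  exact Finset.sum_congr rfl fun α _ => by rw [hs.apply]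

/-- The spinor connection coefficients do not involve the inverse metric: lowering the index of
`∂_μ σ^α + Γ^α_{μβ} σ^β` instead of that of `σ^α` leaves a polynomial in `g`, `σ` and their first
derivatives. -/
theorem spinConn_eq_firstKind {g : MetricField} {σ : PauliField} {x : Coord} (hs : (g x).IsSymm)
    (hdet : (g x).det ≠ 0) (a : Fin 2) (μ : Fin 4) (b : Fin 2) :
    spinConn g σ x a μ b = 1 / 4 * ∑ β, ∑ c,
      (∑ α, (g x α β : ℂ) * partialD μ (fun y => σ y α b c) x
        + ∑ γ, (firstKind (partialMetric g x) β μ γ : ℂ) * σ x γ b c)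
        * raiseSpinor (σ x β) a c := by
  have h : ∀ β c, ∑ α, (g x α β : ℂ) * partialD μ (fun y => σ y α b c) x
        + ∑ γ, (firstKind (partialMetric g x) β μ γ : ℂ) * σ x γ b c
      = ∑ α, (g x α β : ℂ) * (partialD μ (fun y => σ y α b c) x
        + ∑ γ, (christoffel g x α μ γ : ℂ) * σ x γ b c) := fun β c => by
    simp only [mul_add, Finset.sum_add_distrib, ← sum_metric_mul_christoffel hs hdet,
      Complex.ofReal_sum, Complex.ofReal_mul, Finset.sum_mul, Finset.mul_sum]
    congr 1
    rw [Finset.sum_comm]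
    simp only [mul_assoc]
  simp only [h, spinConn, pauliLow, Finset.sum_mul]
  congr 1
  rw [Finset.sum_congr rfl fun α _ => Finset.sum_comm, Finset.sum_comm]
  refine Finset.sum_congr rfl fun β _ => ?_
  rw [Finset.sum_comm]
  refine Finset.sum_congr rfl fun c _ => Finset.sum_congr rfl fun α _ => ?_
  rw [mul_assoc, mul_assoc, mul_comm (raiseSpinor _ _ _)]

/-- The first variation `δσ^α` of a one-parameter family of Pauli matrices at parameter `0`. -/
noncomputable def deltaPauli (σt : ℝ → PauliField) (x : Coord) (α : Fin 4) :
    Matrix (Fin 2) (Fin 2) ℂ :=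
  Matrix.of fun a b => deriv (fun t => σt t x α a b) 0

theorem deltaPauli_apply (σt : ℝ → PauliField) (x : Coord) (α : Fin 4) (a b : Fin 2) :
    deltaPauli σt x α a b = deriv (fun t => σt t x α a b) 0 := rfl

theorem hasDerivAt_raiseSpinor {s : ℝ → Matrix (Fin 2) (Fin 2) ℂ} {s' : Matrix (Fin 2) (Fin 2) ℂ}
    {t : ℝ} (h : ∀ a b, HasDerivAt (fun u => s u a b) (s' a b) t) (a c : Fin 2) :
    HasDerivAt (fun u => raiseSpinor (s u) a c) (raiseSpinor s' a c) t :=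
  HasDerivAt.fun_sum fun _ _ => HasDerivAt.fun_sum fun _ _ =>
    ((h _ _).const_mul _).mul_const _

section Variation

variable {U K : Set Coord} {g : MetricField} {σ : PauliField} {ξ : SpinorField} {r : ℝ}
  {gt : ℝ → MetricField} {σt : ℝ → PauliField}

namespace IsSymmVariation

theorem contDiffAt_metric (hv : IsSymmVariation U g σ K r gt σt) (hU : IsOpen U) {t : ℝ}
    {x : Coord} (ht : t ∈ Ioo (-r) r) (hx : x ∈ U) (i j : Fin 4) :
    ContDiffAt ℝ ∞ (fun p : ℝ × Coord => gt p.1 p.2 i j) (t, x) :=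
  (hv.smooth_metric i j).contDiffAt ((isOpen_Ioo.prod hU).mem_nhds ⟨ht, hx⟩)

theorem contDiffAt_pauli (hv : IsSymmVariation U g σ K r gt σt) (hU : IsOpen U) {t : ℝ}
    {x : Coord} (ht : t ∈ Ioo (-r) r) (hx : x ∈ U) (α : Fin 4) (a b : Fin 2) :
    ContDiffAt ℝ ∞ (fun p : ℝ × Coord => σt p.1 p.2 α a b) (t, x) :=
  (hv.smooth_pauli α a b).contDiffAt ((isOpen_Ioo.prod hU).mem_nhds ⟨ht, hx⟩)

theorem zero_mem (hv : IsSymmVariation U g σ K r gt σt) : (0 : ℝ) ∈ Ioo (-r) r :=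
  ⟨neg_lt_zero.2 hv.pos, hv.pos⟩

theorem metric_zero_eventuallyEq (hv : IsSymmVariation U g σ K r gt σt) (hU : IsOpen U) {x : Coord}
    (hx : x ∈ U) (i j : Fin 4) : (fun y => gt 0 y i j) =ᶠ[𝓝 x] fun y => g y i j := by
  filter_upwards [hU.mem_nhds hx] with y hy using by rw [hv.metric_zero y hy]

theorem pauli_zero_eventuallyEq (hv : IsSymmVariation U g σ K r gt σt) (hU : IsOpen U) {x : Coord}
    (hx : x ∈ U) (α : Fin 4) (a b : Fin 2) :
    (fun y => σt 0 y α a b) =ᶠ[𝓝 x] fun y => σ y α a b := by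
  filter_upwards [hU.mem_nhds hx] with y hy using by rw [hv.pauli_zero y hy]

theorem hasDerivAt_metric (hv : IsSymmVariation U g σ K r gt σt) (hU : IsOpen U) {x : Coord}
    (hx : x ∈ U) (i j : Fin 4) :
    HasDerivAt (fun t => gt t x i j) (deltaMetric gt x i j) 0 :=
  (hasDerivAt_slice ((hv.contDiffAt_metric hU hv.zero_mem hx i j).differentiableAt
    (by simp))).differentiableAt.hasDerivAt

theorem hasDerivAt_pauli (hv : IsSymmVariation U g σ K r gt σt) {x : Coord}
    (hx : x ∈ U) (α : Fin 4) (a b : Fin 2) :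
    HasDerivAt (fun t => σt t x α a b) (deltaPauli σt x α a b) 0 :=
  (hv.pauli_deriv x hx α a b).differentiableAt.hasDerivAt

theorem deltaPauli_eq (hv : IsSymmVariation U g σ K r gt σt) {x : Coord}
    (hx : x ∈ U) (α : Fin 4) :
    deltaPauli σt x α
      = -(1 / 2 : ℝ) • ∑ β, ∑ γ, ((g x)⁻¹ α β * deltaMetric gt x β γ) • σ x γ := by
  ext a b
  rw [deltaPauli_apply, (hv.pauli_deriv x hx α a b).deriv]
  simp [Matrix.sum_apply]

/-- The symmetry condition with the metric on the left: `g_{αβ} δσ^β = -½ δg_{αγ} σ^γ`. -/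
theorem sum_metric_smul_deltaPauli (hv : IsSymmVariation U g σ K r gt σt)
    (hbg : IsBackground U g σ ξ) {x : Coord} (hx : x ∈ U) (α : Fin 4) :
    ∑ β, g x α β • deltaPauli σt x β = -(1 / 2 : ℝ) • ∑ γ, deltaMetric gt x α γ • σ x γ := by
  have h1 : ∀ l, ∑ β, g x α β * (g x)⁻¹ β l = if α = l then 1 else 0 := fun l => by
    rw [← Matrix.mul_apply, Matrix.mul_nonsing_inv _
      (isUnit_iff_ne_zero.2 (hbg.lorentzian x hx).det_ne_zero), Matrix.one_apply]
  have h2 : ∑ β, g x α β • deltaPauli σt x β = -(1 / 2 : ℝ) •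
      ∑ l, (∑ β, g x α β * (g x)⁻¹ β l) • ∑ γ, deltaMetric gt x l γ • σ x γ := by
    simp only [hv.deltaPauli_eq hx, Finset.smul_sum, Finset.sum_smul]
    rw [Finset.sum_comm]
    refine Finset.sum_congr rfl fun l _ => ?_
    rw [Finset.sum_comm]
    conv_rhs => rw [Finset.sum_comm]
    rw [Finset.sum_comm]
    refine Finset.sum_congr rfl fun β _ => Finset.sum_congr rfl fun γ _ => ?_
    module
  rw [h2]
  simp [h1]

theorem isHermitian_deltaPauli (hv : IsSymmVariation U g σ K r gt σt)
    (hbg : IsBackground U g σ ξ) {x : Coord} (hx : x ∈ U) (α : Fin 4) :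
    (deltaPauli σt x α).IsHermitian := by
  rw [hv.deltaPauli_eq hx]
  exact IsHermitian.real_smul (IsHermitian.sum fun β _ => IsHermitian.sum fun γ _ =>
    IsHermitian.real_smul ((hbg.pauli x hx).isHermitian γ) _) _

theorem deltaMetric_symm (hv : IsSymmVariation U g σ K r gt σt) {x : Coord} (hx : x ∈ U)
    (i j : Fin 4) : deltaMetric gt x i j = deltaMetric gt x j i := by
  refine Filter.EventuallyEq.deriv_eq ?_
  filter_upwards [isOpen_Ioo.mem_nhds hv.zero_mem] with t ht using (hv.symm t ht x hx).apply j i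

theorem eventually_det_ne_zero (hv : IsSymmVariation U g σ K r gt σt) (hU : IsOpen U)
    (hbg : IsBackground U g σ ξ) {x : Coord} (hx : x ∈ U) :
    ∀ᶠ t in 𝓝 (0 : ℝ), (gt t x).det ≠ 0 := by
  have h := (hasDerivAt_det (A := fun t => gt t x)
    fun i j => hv.hasDerivAt_metric hU hx i j).continuousAt
  refine h.eventually_ne ?_
  rw [hv.metric_zero x hx]
  exact (hbg.lorentzian x hx).det_ne_zero

theorem hasDerivAt_partialMetric (hv : IsSymmVariation U g σ K r gt σt) (hU : IsOpen U)
    {x : Coord} (hx : x ∈ U) (k i j : Fin 4) :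
    HasDerivAt (fun t => partialMetric (gt t) x k i j)
      (partialMetric (fun y => Matrix.of (deltaMetric gt y)) x k i j) 0 :=
  hasDerivAt_partialD (f := fun p : ℝ × Coord => gt p.1 p.2 i j)
    ((hv.contDiffAt_metric hU hv.zero_mem hx i j).of_le (WithTop.coe_le_coe.2 le_top)) k

theorem hasDerivAt_partialPauli (hv : IsSymmVariation U g σ K r gt σt) (hU : IsOpen U)
    {x : Coord} (hx : x ∈ U) (k α : Fin 4) (a b : Fin 2) :
    HasDerivAt (fun t => partialD k (fun y => σt t y α a b) x)
      (partialD k (fun y => deltaPauli σt y α a b) x) 0 :=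
  hasDerivAt_partialD (f := fun p : ℝ × Coord => σt p.1 p.2 α a b)
    ((hv.contDiffAt_pauli hU hv.zero_mem hx α a b).of_le (WithTop.coe_le_coe.2 le_top)) k

end IsSymmVariation

/-- The matrices `∂_k σ^α`. -/
noncomputable def partialPauli (σ : PauliField) (x : Coord) (k α : Fin 4) :
    Matrix (Fin 2) (Fin 2) ℂ :=
  Matrix.of fun a b => partialD k (fun y => σ y α a b) x

/-- The first variation of the transposed spinor connection matrix `(Γ_μ)ᵀ`. -/
noncomputable def deltaConn (g : MetricField) (σ : PauliField) (gt : ℝ → MetricField)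
    (σt : ℝ → PauliField) (x : Coord) (μ : Fin 4) : Matrix (Fin 2) (Fin 2) ℂ :=
  (1 / 4 : ℝ) • ∑ β, ((∑ α, (deltaMetric gt x α β • partialPauli σ x μ α
            + g x α β • partialPauli (deltaPauli σt) x μ α)
          + ∑ γ, (firstKind (partialMetric (fun y => Matrix.of (deltaMetric gt y)) x) β μ γ • σ x γ
            + firstKind (partialMetric g x) β μ γ • deltaPauli σt x γ)) * adjugateTwo (σ x β)
        + (∑ α, g x α β • partialPauli σ x μ α
          + ∑ γ, firstKind (partialMetric g x) β μ γ • σ x γ) * adjugateTwo (deltaPauli σt x β))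

theorem IsSymmVariation.hasDerivAt_spinConn (hv : IsSymmVariation U g σ K r gt σt) (hU : IsOpen U)
    (hbg : IsBackground U g σ ξ) {x : Coord} (hx : x ∈ U) (a : Fin 2) (μ : Fin 4) (b : Fin 2) :
    HasDerivAt (fun t => spinConn (gt t) (σt t) x a μ b) (deltaConn g σ gt σt x μ b a) 0 := by
  have hev : (fun t => spinConn (gt t) (σt t) x a μ b) =ᶠ[𝓝 0] fun t => 1 / 4 * ∑ β, ∑ c,
      (∑ α, (gt t x α β : ℂ) * partialD μ (fun y => σt t y α b c) x
        + ∑ γ, (firstKind (partialMetric (gt t) x) β μ γ : ℂ) * σt t x γ b c)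
        * raiseSpinor (σt t x β) a c := by
    filter_upwards [hv.eventually_det_ne_zero hU hbg hx, isOpen_Ioo.mem_nhds hv.zero_mem]
      with t hdet ht
    exact spinConn_eq_firstKind (hv.symm t ht x hx) hdet a μ b
  refine HasDerivAt.congr_of_eventuallyEq ?_ hev
  have hfk : ∀ β γ, HasDerivAt (fun t => firstKind (partialMetric (gt t) x) β μ γ)
      (firstKind (partialMetric (fun y => Matrix.of (deltaMetric gt y)) x) β μ γ) 0 := fun β γ =>
    (((hv.hasDerivAt_partialMetric hU hx _ _ _).add
      (hv.hasDerivAt_partialMetric hU hx _ _ _)).sub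
      (hv.hasDerivAt_partialMetric hU hx _ _ _)).const_mul _
  have hd := HasDerivAt.const_mul (1 / 4 : ℂ) <| HasDerivAt.fun_sum (u := Finset.univ) fun β _ =>
    HasDerivAt.fun_sum (u := Finset.univ) fun c _ =>
      ((HasDerivAt.fun_sum (u := Finset.univ) fun α _ =>
          (hv.hasDerivAt_metric hU hx α β).ofReal_comp.mul
            (hv.hasDerivAt_partialPauli hU hx μ α b c)).add
        (HasDerivAt.fun_sum (u := Finset.univ) fun γ _ =>
          (hfk β γ).ofReal_comp.mul (hv.hasDerivAt_pauli hx γ b c))).mul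
      (hasDerivAt_raiseSpinor (fun i j => hv.hasDerivAt_pauli hx β i j) a c)
  refine hd.congr_deriv ?_
  have hpm : partialMetric (gt 0) x = partialMetric g x := by
    ext k i j
    exact partialD_congr (hv.metric_zero_eventuallyEq hU hx i j) k
  have hpp : ∀ α i j, partialD μ (fun y => σt 0 y α i j) x = partialD μ (fun y => σ y α i j) x :=
    fun α i j =>
      partialD_congr (hv.pauli_zero_eventuallyEq hU hx α i j) μ
  simp only [Pi.mul_apply, Pi.add_apply, hpm, hpp, hv.metric_zero x hx, hv.pauli_zero x hx,
    deltaConn, Matrix.smul_apply, Matrix.sum_apply, Matrix.add_apply, Matrix.mul_apply,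
    raiseSpinor_eq_adjugateTwo, partialPauli, Matrix.of_apply, Complex.real_smul]
  simp only [← Finset.sum_add_distrib]
  push_cast
  rfl

/-- The hypotheses of `isHermitian_connection_variation` hold at every point: the symmetry condition
is an identity of functions on `U`, so it may be differentiated in `x`. -/
theorem IsSymmVariation.isHermitian_sum_deltaConn_mul (hv : IsSymmVariation U g σ K r gt σt)
    (hU : IsOpen U) (hbg : IsBackground U g σ ξ) {x : Coord} (hx : x ∈ U) :
    (∑ μ, deltaConn g σ gt σt x μ * σ x μ).IsHermitian := by
  have hcg : ∀ i j, DifferentiableAt ℝ (fun y => g y i j) x := fun i j =>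
    ((hbg.smooth_metric i j).contDiffAt (hU.mem_nhds hx)).differentiableAt (by simp)
  have hcσ : ∀ α a b, DifferentiableAt ℝ (fun y => σ y α a b) x := fun α a b =>
    ((hbg.smooth_pauli α a b).contDiffAt (hU.mem_nhds hx)).differentiableAt (by simp)
  have hch : ∀ i j, DifferentiableAt ℝ (fun y => deltaMetric gt y i j) x := fun i j =>
    differentiableAt_deriv_slice (f := fun p : ℝ × Coord => gt p.1 p.2 i j)
      ((hv.contDiffAt_metric hU hv.zero_mem hx i j).of_le (WithTop.coe_le_coe.2 le_top))
  have hcτ : ∀ α a b, DifferentiableAt ℝ (fun y => deltaPauli σt y α a b) x := fun α a b =>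
    differentiableAt_deriv_slice (f := fun p : ℝ × Coord => σt p.1 p.2 α a b)
      ((hv.contDiffAt_pauli hU hv.zero_mem hx α a b).of_le (WithTop.coe_le_coe.2 le_top))
  have hmul : ∀ (u : Coord → ℝ) (v : Coord → ℂ) (μ : Fin 4), DifferentiableAt ℝ u x →
      DifferentiableAt ℝ v x → partialD μ (fun y => u y • v y) x
        = partialD μ u x • v x + u x • partialD μ v x := fun u v μ hu hv => by
    simp only [partialD]
    rw [fderiv_fun_smul hu hv]
    simp [add_comm]
  have hsum : ∀ (u : Fin 4 → Coord → ℝ) (v : Fin 4 → Coord → ℂ) (μ : Fin 4),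
      (∀ i, DifferentiableAt ℝ (u i) x) → (∀ i, DifferentiableAt ℝ (v i) x) →
      partialD μ (fun y => ∑ i, u i y • v i y) x
        = ∑ i, (partialD μ (u i) x • v i x + u i x • partialD μ (v i) x) := fun u v μ hu hv => by
    rw [partialD, fderiv_fun_sum fun i _ => (hu i).fun_smul (hv i), sum_apply]
    exact Finset.sum_congr rfl fun i _ => hmul _ _ μ (hu i) (hv i)
  have key := isHermitian_connection_variation (s := σ x) (τ := deltaPauli σt x)
    (ds := partialPauli σ x) (dτ := partialPauli (deltaPauli σt) x) (g := g x)
    (h := deltaMetric gt x) (dg := partialMetric g x)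
    (dh := partialMetric (fun y => Matrix.of (deltaMetric gt y)) x)
    (hbg.pauli x hx).isHermitian (hv.isHermitian_deltaPauli hbg hx)
    (fun i j => (hbg.lorentzian x hx).1.apply j i) (hv.deltaMetric_symm hx)
    (partialMetric_symm (by
      filter_upwards [hU.mem_nhds hx] with y hy using (hbg.lorentzian y hy).1))
    (partialMetric_symm (by
      filter_upwards [hU.mem_nhds hx] with y hy
      exact Matrix.IsSymm.ext fun i j => hv.deltaMetric_symm hy j i))
    (hv.sum_metric_smul_deltaPauli hbg hx)
    (fun μ α => by
      ext a b
      have e : (fun y => ∑ β, g y α β • deltaPauli σt y β a b) =ᶠ[𝓝 x]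
          fun y => -(1 / 2 : ℝ) • ∑ γ, deltaMetric gt y α γ • σ y γ a b := by
        filter_upwards [hU.mem_nhds hx] with y hy
        have := congrFun (congrFun (hv.sum_metric_smul_deltaPauli hbg hy α) a) b
        simpa only [Matrix.sum_apply, Matrix.smul_apply] using this
      have e' : partialD μ (fun y => ∑ β, g y α β • deltaPauli σt y β a b) x
          = partialD μ (fun y => -(1 / 2 : ℝ) • ∑ γ, deltaMetric gt y α γ • σ y γ a b) x :=
        partialD_congr e μ
      have e'' : partialD μ (fun y => -(1 / 2 : ℝ) • ∑ γ, deltaMetric gt y α γ • σ y γ a b) x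
          = -(1 / 2 : ℝ) • partialD μ (fun y => ∑ γ, deltaMetric gt y α γ • σ y γ a b) x := by
        rw [partialD, fderiv_fun_const_smul
          (DifferentiableAt.fun_sum fun γ _ => (hch α γ).fun_smul (hcσ γ a b))]
        rfl
      rw [e'', hsum _ _ μ (fun β => hcg α β) (fun β => hcτ β a b),
        hsum _ _ μ (fun β => hch α β) (fun β => hcσ β a b)] at e'
      simp only [Matrix.sum_apply, Matrix.smul_apply, Matrix.add_apply]
      exact e')
  have h4 := IsHermitian.real_smul key (1 / 4)
  rw [Finset.smul_sum] at h4
  refine (congrArg Matrix.IsHermitian ?_).mpr h4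
  exact Finset.sum_congr rfl fun μ _ => smul_mul_assoc _ _ _

theorem IsSymmVariation.hasDerivAt_nablaSpinor (hv : IsSymmVariation U g σ K r gt σt)
    (hU : IsOpen U) (hbg : IsBackground U g σ ξ) {x : Coord} (hx : x ∈ U) (μ : Fin 4)
    (a : Fin 2) :
    HasDerivAt (fun t => nablaSpinor (gt t) (σt t) ξ x μ a)
      (∑ b, deltaConn g σ gt σt x μ b a * ξ x b) 0 :=
  (HasDerivAt.fun_sum fun b _ => (hv.hasDerivAt_spinConn hU hbg hx a μ b).mul_const _).const_add _

theorem IsSymmVariation.hasDerivAt_nablaSpinorBar (hv : IsSymmVariation U g σ K r gt σt)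
    (hU : IsOpen U) (hbg : IsBackground U g σ ξ) {x : Coord} (hx : x ∈ U) (μ : Fin 4)
    (a : Fin 2) :
    HasDerivAt (fun t => nablaSpinorBar (gt t) (σt t) ξ x μ a)
      (∑ b, conj (deltaConn g σ gt σt x μ b a) * conj (ξ x b)) 0 :=
  (HasDerivAt.fun_sum fun b _ =>
    ((hv.hasDerivAt_spinConn hU hbg hx a μ b).star).mul_const _).const_add _

/-- The terms of the first variation that contain the varied covariant derivatives cancel
pointwise. -/
theorem IsSymmVariation.weylForm_deltaNabla (hv : IsSymmVariation U g σ K r gt σt)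
    (hU : IsOpen U) (hbg : IsBackground U g σ ξ) {x : Coord} (hx : x ∈ U) :
    weylForm (σ x) (ξ x) (deltaNabla gt σt ξ x) (deltaNablaBar gt σt ξ x) = 0 := by
  have h1 : deltaNabla gt σt ξ x = fun μ a => ∑ b, deltaConn g σ gt σt x μ b a * ξ x b := by
    ext μ a
    exact (hv.hasDerivAt_nablaSpinor hU hbg hx μ a).deriv
  have h2 : deltaNablaBar gt σt ξ x
      = fun μ a => ∑ b, conj (deltaConn g σ gt σt x μ b a) * conj (ξ x b) := by
    ext μ a
    exact (hv.hasDerivAt_nablaSpinorBar hU hbg hx μ a).deriv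
  rw [h1, h2]
  exact weylForm_eq_zero (hbg.pauli x hx).isHermitian (hv.isHermitian_sum_deltaConn_mul hU hbg hx) _

end Variation

/-! ### The variation of the action -/

section Smoothness

variable {X : Type*} [NormedAddCommGroup X] [NormedSpace ℝ X] {p : X}

theorem contDiffAt_det {A : X → Matrix (Fin 4) (Fin 4) ℝ}
    (hA : ∀ i j, ContDiffAt ℝ ∞ (fun q => A q i j) p) : ContDiffAt ℝ ∞ (fun q => (A q).det) p := by
  simp only [Matrix.det_apply]
  exact ContDiffAt.sum fun τ _ => (contDiffAt_prod fun i _ => hA _ _).const_smul _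

theorem contDiffAt_inv_apply {A : X → Matrix (Fin 4) (Fin 4) ℝ}
    (hA : ∀ i j, ContDiffAt ℝ ∞ (fun q => A q i j) p) (hdet : (A p).det ≠ 0) (i j : Fin 4) :
    ContDiffAt ℝ ∞ (fun q => (A q)⁻¹ i j) p := by
  simp only [Matrix.inv_def, Ring.inverse_eq_inv', Matrix.smul_apply, smul_eq_mul,
    Matrix.adjugate_apply]
  refine ((contDiffAt_det hA).inv hdet).mul (contDiffAt_det fun k l => ?_)
  simp only [Matrix.updateRow_apply]
  split_ifs
  · exact contDiffAt_const
  · exact hA k l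

theorem contDiffAt_ofReal {f : X → ℝ} (hf : ContDiffAt ℝ ∞ f p) :
    ContDiffAt ℝ ∞ (fun q => (f q : ℂ)) p :=
  Complex.ofRealCLM.contDiff.contDiffAt.comp p hf

theorem contDiffAt_conj {f : X → ℂ} (hf : ContDiffAt ℝ ∞ f p) :
    ContDiffAt ℝ ∞ (fun q => conj (f q)) p :=
  Complex.conjCLE.contDiff.contDiffAt.comp p hf

theorem contDiffAt_raiseSpinor {s : X → Matrix (Fin 2) (Fin 2) ℂ}
    (hs : ∀ a b, ContDiffAt ℝ ∞ (fun q => s q a b) p) (a c : Fin 2) :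
    ContDiffAt ℝ ∞ (fun q => raiseSpinor (s q) a c) p :=
  ContDiffAt.sum fun _ _ => ContDiffAt.sum fun _ _ =>
    (contDiffAt_const.mul (hs _ _)).mul contDiffAt_const

variable {gt : ℝ → MetricField} {σt : ℝ → PauliField} {ξ : SpinorField} {p : ℝ × Coord}

theorem contDiffAt_christoffel (hg : ∀ i j, ContDiffAt ℝ ∞ (fun q : ℝ × Coord => gt q.1 q.2 i j) p)
    (hdet : (gt p.1 p.2).det ≠ 0) (κ μ ν : Fin 4) :
    ContDiffAt ℝ ∞ (fun q : ℝ × Coord => christoffel (gt q.1) q.2 κ μ ν) p :=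
  contDiffAt_const.mul <| ContDiffAt.sum fun _ _ =>
    (contDiffAt_inv_apply (A := fun q : ℝ × Coord => gt q.1 q.2) hg hdet _ _).mul <|
      ((contDiffAt_partialD (hg _ _) _).add (contDiffAt_partialD (hg _ _) _)).sub
        (contDiffAt_partialD (hg _ _) _)

theorem contDiffAt_spinConn (hg : ∀ i j, ContDiffAt ℝ ∞ (fun q : ℝ × Coord => gt q.1 q.2 i j) p)
    (hσ : ∀ α a b, ContDiffAt ℝ ∞ (fun q : ℝ × Coord => σt q.1 q.2 α a b) p)
    (hdet : (gt p.1 p.2).det ≠ 0) (a : Fin 2) (μ : Fin 4) (b : Fin 2) :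
    ContDiffAt ℝ ∞ (fun q : ℝ × Coord => spinConn (gt q.1) (σt q.1) q.2 a μ b) p :=
  contDiffAt_const.mul <| ContDiffAt.sum fun α _ => ContDiffAt.sum fun c _ =>
    (ContDiffAt.sum fun β _ => (contDiffAt_ofReal (hg α β)).mul
      (contDiffAt_raiseSpinor (s := fun q : ℝ × Coord => σt q.1 q.2 β) (hσ β) a c)).mul <|
    (contDiffAt_partialD (hσ α b c) μ).add <| ContDiffAt.sum fun β _ =>
      (contDiffAt_ofReal (contDiffAt_christoffel hg hdet α μ β)).mul (hσ β b c)

theorem contDiffAt_nablaSpinor (hg : ∀ i j, ContDiffAt ℝ ∞ (fun q : ℝ × Coord => gt q.1 q.2 i j) p)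
    (hσ : ∀ α a b, ContDiffAt ℝ ∞ (fun q : ℝ × Coord => σt q.1 q.2 α a b) p)
    (hξ : ∀ a, ContDiffAt ℝ ∞ (fun q : ℝ × Coord => ξ q.2 a) p)
    (hdet : (gt p.1 p.2).det ≠ 0) (μ : Fin 4) (a : Fin 2) :
    ContDiffAt ℝ ∞ (fun q : ℝ × Coord => nablaSpinor (gt q.1) (σt q.1) ξ q.2 μ a) p :=
  (contDiffAt_partialD (hξ a) μ).add <| ContDiffAt.sum fun b _ =>
    (contDiffAt_spinConn hg hσ hdet a μ b).mul (hξ b)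

theorem contDiffAt_nablaSpinorBar
    (hg : ∀ i j, ContDiffAt ℝ ∞ (fun q : ℝ × Coord => gt q.1 q.2 i j) p)
    (hσ : ∀ α a b, ContDiffAt ℝ ∞ (fun q : ℝ × Coord => σt q.1 q.2 α a b) p)
    (hξ : ∀ a, ContDiffAt ℝ ∞ (fun q : ℝ × Coord => ξ q.2 a) p)
    (hdet : (gt p.1 p.2).det ≠ 0) (μ : Fin 4) (a : Fin 2) :
    ContDiffAt ℝ ∞ (fun q : ℝ × Coord => nablaSpinorBar (gt q.1) (σt q.1) ξ q.2 μ a) p :=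
  (contDiffAt_partialD (contDiffAt_conj (hξ a)) μ).add <| ContDiffAt.sum fun b _ =>
    (contDiffAt_conj (contDiffAt_spinConn hg hσ hdet a μ b)).mul (contDiffAt_conj (hξ b))

theorem contDiffAt_volDensity (hg : ∀ i j, ContDiffAt ℝ ∞ (fun q : ℝ × Coord => gt q.1 q.2 i j) p)
    (hdet : (gt p.1 p.2).det ≠ 0) :
    ContDiffAt ℝ ∞ (fun q : ℝ × Coord => volDensity (gt q.1) q.2) p :=
  ((contDiffAt_det (A := fun q : ℝ × Coord => gt q.1 q.2) hg).abs hdet).sqrt (abs_ne_zero.2 hdet)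

theorem contDiffAt_neutrinoDensity
    (hg : ∀ i j, ContDiffAt ℝ ∞ (fun q : ℝ × Coord => gt q.1 q.2 i j) p)
    (hσ : ∀ α a b, ContDiffAt ℝ ∞ (fun q : ℝ × Coord => σt q.1 q.2 α a b) p)
    (hξ : ∀ a, ContDiffAt ℝ ∞ (fun q : ℝ × Coord => ξ q.2 a) p)
    (hdet : (gt p.1 p.2).det ≠ 0) :
    ContDiffAt ℝ ∞ (fun q : ℝ × Coord => neutrinoDensity (gt q.1) (σt q.1) ξ q.2) p :=
  (ContDiffAt.sum fun μ _ => ContDiffAt.sum fun a _ => ContDiffAt.sum fun b _ =>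
    (((hξ a).mul (hσ μ a b)).mul (contDiffAt_nablaSpinorBar hg hσ hξ hdet μ b)).sub
      (((contDiffAt_nablaSpinor hg hσ hξ hdet μ a).mul (hσ μ a b)).mul
        (contDiffAt_conj (hξ b)))).mul (contDiffAt_ofReal (contDiffAt_volDensity hg hdet))

end Smoothness

section EnergyMomentum

variable {U K : Set Coord} {g : MetricField} {σ : PauliField} {ξ : SpinorField} {r : ℝ}
  {gt : ℝ → MetricField} {σt : ℝ → PauliField}

/-- The canonical tensor `J_κ^γ = ξ^a σ^γ_{aḃ} ∇_κ ξ̄^ḃ - (∇_κ ξ^a) σ^γ_{aḃ} ξ̄^ḃ`, whose trace is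
the Weyl form and whose symmetric part is the first part of the energy-momentum tensor. -/
noncomputable def canonicalTensor (g : MetricField) (σ : PauliField) (ξ : SpinorField) (x : Coord)
    (κ γ : Fin 4) : ℂ :=
  ∑ a, ∑ b, (ξ x a * σ x γ a b * nablaSpinorBar g σ ξ x κ b
    - nablaSpinor g σ ξ x κ a * σ x γ a b * conj (ξ x b))

theorem weylForm_eq_sum_canonicalTensor (g : MetricField) (σ : PauliField) (ξ : SpinorField)
    (x : Coord) :
    weylForm (σ x) (ξ x) (nablaSpinor g σ ξ x) (nablaSpinorBar g σ ξ x)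
      = ∑ κ, canonicalTensor g σ ξ x κ κ := rfl

theorem energyMomentum_eq (g : MetricField) (σ : PauliField) (ξ : SpinorField) (x : Coord)
    (μ ν : Fin 4) :
    energyMomentum g σ ξ x μ ν
      = -(Complex.I / 2) * ∑ κ, (((g x)⁻¹ μ κ : ℝ) * canonicalTensor g σ ξ x κ ν
          + ((g x)⁻¹ ν κ : ℝ) * canonicalTensor g σ ξ x κ μ)
        + Complex.I * (∑ κ, canonicalTensor g σ ξ x κ κ) * ((g x)⁻¹ μ ν : ℝ) := by
  simp only [energyMomentum, canonicalTensor, nablaSpinorUp, nablaSpinorBarUp, Fin.sum_univ_two,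
    Fin.sum_univ_four]
  ring

/-- The contraction of the energy-momentum tensor with a symmetric `h`: the first term comes from
`δσ^κ = -½ g^{κβ} h_{βγ} σ^γ`, the second from `δ√|det g|`. -/
theorem sum_energyMomentum_mul {h : Fin 4 → Fin 4 → ℝ} (hh : ∀ i j, h i j = h j i) {x : Coord}
    (hg : ∀ i j, (g x)⁻¹ i j = (g x)⁻¹ j i) :
    ∑ μ, ∑ ν, energyMomentum g σ ξ x μ ν * (h μ ν : ℂ)
      = -Complex.I * ∑ κ, ∑ β, ∑ γ, (((g x)⁻¹ κ β * h β γ : ℝ) : ℂ) * canonicalTensor g σ ξ x κ γ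
        + Complex.I * (∑ κ, canonicalTensor g σ ξ x κ κ)
          * ((∑ μ, ∑ ν, (g x)⁻¹ μ ν * h μ ν : ℝ) : ℂ) := by
  set J := canonicalTensor g σ ξ x
  have e1 : ∑ μ, ∑ ν, (∑ κ, (((g x)⁻¹ μ κ : ℝ) : ℂ) * J κ ν) * (h μ ν : ℂ)
      = ∑ κ, ∑ β, ∑ γ, (((g x)⁻¹ κ β * h β γ : ℝ) : ℂ) * J κ γ := by
    simp only [Finset.sum_mul]
    conv_rhs => rw [Finset.sum_comm]
    refine Finset.sum_congr rfl fun μ _ => ?_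
    rw [Finset.sum_comm]
    refine Finset.sum_congr rfl fun κ _ => Finset.sum_congr rfl fun ν _ => ?_
    rw [hg]
    push_cast
    ring
  have e2 : ∑ μ, ∑ ν, (∑ κ, (((g x)⁻¹ ν κ : ℝ) : ℂ) * J κ μ) * (h μ ν : ℂ)
      = ∑ κ, ∑ β, ∑ γ, (((g x)⁻¹ κ β * h β γ : ℝ) : ℂ) * J κ γ := by
    rw [Finset.sum_comm, ← e1]
    exact Finset.sum_congr rfl fun κ _ => Finset.sum_congr rfl fun ν _ => by rw [hh]
  have e3 : ∑ μ, ∑ ν, energyMomentum g σ ξ x μ ν * (h μ ν : ℂ)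
      = -(Complex.I / 2) * (∑ μ, ∑ ν, (∑ κ, (((g x)⁻¹ μ κ : ℝ) : ℂ) * J κ ν) * (h μ ν : ℂ))
        + -(Complex.I / 2) * (∑ μ, ∑ ν, (∑ κ, (((g x)⁻¹ ν κ : ℝ) : ℂ) * J κ μ) * (h μ ν : ℂ))
        + Complex.I * (∑ κ, J κ κ) * ∑ μ, ∑ ν, (((g x)⁻¹ μ ν : ℝ) : ℂ) * (h μ ν : ℂ) := by
    simp only [energyMomentum_eq, Finset.sum_add_distrib]
    simp only [add_mul, mul_add, Finset.sum_add_distrib, Finset.mul_sum (Finset.univ (α := Fin 4))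
      (fun μ => ∑ ν, _ * _), Finset.mul_sum Finset.univ (fun ν => _ * (h _ ν : ℂ)), mul_assoc, J]
  rw [e3, e1, e2]
  push_cast
  ring

/-- The first variation of the volume density, `δ√|det g| = ½ √|det g| g^{μν} δg_{μν}`. -/
theorem IsSymmVariation.hasDerivAt_volDensity (hv : IsSymmVariation U g σ K r gt σt)
    (hU : IsOpen U) (hbg : IsBackground U g σ ξ) {x : Coord} (hx : x ∈ U) :
    HasDerivAt (fun t => volDensity (gt t) x)
      (1 / 2 * (∑ μ, ∑ ν, (g x)⁻¹ μ ν * deltaMetric gt x μ ν) * volDensity g x) 0 := by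
  have hd : (g x).det ≠ 0 := (hbg.lorentzian x hx).det_ne_zero
  have h1 := hasDerivAt_det (A := fun t => gt t x) (A' := Matrix.of (deltaMetric gt x))
    fun i j => hv.hasDerivAt_metric hU hx i j
  have h0 : gt 0 x = g x := hv.metric_zero x hx
  have h2 := ((hasDerivAt_abs (by rw [h0]; exact hd)).comp (0 : ℝ) h1).sqrt
    (by simpa only [Function.comp, h0] using abs_ne_zero.2 hd)
  refine h2.congr_deriv ?_
  have htr : ((g x).adjugate * Matrix.of (deltaMetric gt x)).trace
      = (g x).det * ∑ μ, ∑ ν, (g x)⁻¹ μ ν * deltaMetric gt x μ ν := by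
    have : (g x).adjugate = (g x).det • (g x)⁻¹ := by
      rw [Matrix.inv_def, Ring.inverse_eq_inv', smul_smul, mul_inv_cancel₀ hd, one_smul]
    rw [this, Matrix.smul_mul, Matrix.trace_smul, smul_eq_mul]
    congr 1
    refine Finset.sum_congr rfl fun μ _ => ?_
    rw [Matrix.diag_apply, Matrix.mul_apply]
    exact Finset.sum_congr rfl fun ν _ => by rw [Matrix.of_apply, hv.deltaMetric_symm hx]
  have hs : 0 < Real.sqrt |(g x).det| := Real.sqrt_pos.2 (abs_pos.2 hd)
  simp only [Function.comp, h0, htr, volDensity]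
  rw [div_eq_iff (by positivity), ← mul_assoc, sign_mul_self]
  nth_rewrite 1 [← Real.mul_self_sqrt (abs_nonneg (g x).det)]
  ring

theorem IsSymmVariation.contDiffAt_neutrinoDensity (hv : IsSymmVariation U g σ K r gt σt)
    (hU : IsOpen U) (hbg : IsBackground U g σ ξ) {x : Coord} (hx : x ∈ U) :
    ContDiffAt ℝ ∞ (fun q : ℝ × Coord => neutrinoDensity (gt q.1) (σt q.1) ξ q.2) (0, x) :=
  Neutrino.contDiffAt_neutrinoDensity (hv.contDiffAt_metric hU hv.zero_mem hx)
    (hv.contDiffAt_pauli hU hv.zero_mem hx)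
    (fun a => ((hbg.smooth_spinor a).contDiffAt (hU.mem_nhds hx)).comp (0, x) contDiffAt_snd)
    (by
      rw [hv.metric_zero x hx]
      exact (hbg.lorentzian x hx).det_ne_zero)

/-- The pointwise first variation of the integrand of the action. -/
theorem IsSymmVariation.hasDerivAt_neutrinoDensity (hv : IsSymmVariation U g σ K r gt σt)
    (hU : IsOpen U) (hbg : IsBackground U g σ ξ) {x : Coord} (hx : x ∈ U) :
    HasDerivAt (fun t => 2 * Complex.I * neutrinoDensity (gt t) (σt t) ξ x)
      ((∑ μ, ∑ ν, energyMomentum g σ ξ x μ ν * (deltaMetric gt x μ ν : ℂ)) * volDensity g x) 0 := by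
  have hN := fun μ a => (hv.hasDerivAt_nablaSpinor hU hbg hx μ a).differentiableAt.hasDerivAt
  have hNb := fun μ a => (hv.hasDerivAt_nablaSpinorBar hU hbg hx μ a).differentiableAt.hasDerivAt
  have hconn : spinConn (gt 0) (σt 0) x = spinConn g σ x := by
    ext a μ b
    simp only [spinConn, pauliLow, christoffel, hv.metric_zero x hx, hv.pauli_zero x hx,
      partialD_congr (hv.metric_zero_eventuallyEq hU hx _ _),
      partialD_congr (hv.pauli_zero_eventuallyEq hU hx _ _ _)]
  have hN0 : nablaSpinor (gt 0) (σt 0) ξ x = nablaSpinor g σ ξ x := by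
    ext μ a
    simp only [nablaSpinor, hconn]
  have hNb0 : nablaSpinorBar (gt 0) (σt 0) ξ x = nablaSpinorBar g σ ξ x := by
    ext μ a
    simp only [nablaSpinorBar, hconn]
  have hw : HasDerivAt (fun t => weylForm (σt t x) (ξ x) (nablaSpinor (gt t) (σt t) ξ x)
        (nablaSpinorBar (gt t) (σt t) ξ x))
      (weylForm (deltaPauli σt x) (ξ x) (nablaSpinor g σ ξ x) (nablaSpinorBar g σ ξ x)
        + weylForm (σ x) (ξ x) (deltaNabla gt σt ξ x) (deltaNablaBar gt σt ξ x)) 0 := by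
    have h := HasDerivAt.fun_sum (u := Finset.univ) fun μ _ =>
      HasDerivAt.fun_sum (u := Finset.univ) fun a _ =>
      HasDerivAt.fun_sum (u := Finset.univ) fun b _ =>
        (((hv.hasDerivAt_pauli hx μ a b).const_mul (ξ x a)).mul (hNb μ b)).sub
          (((hN μ a).mul (hv.hasDerivAt_pauli hx μ a b)).mul_const (conj (ξ x b)))
    refine h.congr_deriv ?_
    simp only [weylForm, ← Finset.sum_add_distrib, hv.pauli_zero x hx, hN0, hNb0]
    refine Finset.sum_congr rfl fun μ _ => Finset.sum_congr rfl fun a _ =>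
      Finset.sum_congr rfl fun b _ => ?_
    simp only [deltaNabla, deltaNablaBar]
    ring
  rw [hv.weylForm_deltaNabla hU hbg hx, add_zero] at hw
  refine ((hw.mul (hv.hasDerivAt_volDensity hU hbg hx).ofReal_comp).const_mul
    (2 * Complex.I)).congr_deriv ?_
  have hδ : weylForm (deltaPauli σt x) (ξ x) (nablaSpinor g σ ξ x) (nablaSpinorBar g σ ξ x)
      = -(1 / 2) * ∑ κ, ∑ β, ∑ γ, (((g x)⁻¹ κ β * deltaMetric gt x β γ : ℝ) : ℂ)
          * canonicalTensor g σ ξ x κ γ := by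
    simp only [weylForm, Finset.mul_sum (Finset.univ (α := Fin 4)) (fun κ => ∑ β, _)]
    refine Finset.sum_congr rfl fun κ _ => ?_
    simp only [deltaPauli_apply, (hv.pauli_deriv x hx _ _ _).deriv, canonicalTensor,
      Fin.sum_univ_two]
    simp only [Finset.mul_sum, Finset.sum_mul, ← Finset.sum_add_distrib, ← Finset.sum_sub_distrib]
    refine Finset.sum_congr rfl fun β _ => Finset.sum_congr rfl fun γ _ => ?_
    ring
  rw [sum_energyMomentum_mul (hv.deltaMetric_symm hx) (hbg.lorentzian x hx).inv_apply_comm, hδ,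
    hv.pauli_zero x hx, hN0, hNb0,
    weylForm_eq_sum_canonicalTensor, volDensity, hv.metric_zero x hx, ← volDensity]
  push_cast
  ring

theorem continuousOn_energyMomentum (hU : IsOpen U) (hbg : IsBackground U g σ ξ) (μ ν : Fin 4) :
    ContinuousOn (fun x => energyMomentum g σ ξ x μ ν) U := by
  intro x hx
  have hd := (hbg.lorentzian x hx).det_ne_zero
  have hcg : ∀ i j, ContDiffAt ℝ ∞ (fun y => g y i j) x := fun i j =>
    (hbg.smooth_metric i j).contDiffAt (hU.mem_nhds hx)
  have hcσ : ∀ α a b, ContDiffAt ℝ ∞ (fun y => σ y α a b) x := fun α a b =>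
    (hbg.smooth_pauli α a b).contDiffAt (hU.mem_nhds hx)
  have hcξ : ∀ a, ContDiffAt ℝ ∞ (fun y => ξ y a) x := fun a =>
    (hbg.smooth_spinor a).contDiffAt (hU.mem_nhds hx)
  have hinv := contDiffAt_inv_apply hcg hd
  -- the covariant derivatives are those of the constant family
  have hι : ContDiffAt ℝ ∞ (fun y : Coord => ((0 : ℝ), y)) x :=
    contDiffAt_const.prodMk contDiffAt_id
  have hlift : ∀ {F : Type} [NormedAddCommGroup F] [NormedSpace ℝ F] {f : Coord → F},
      ContDiffAt ℝ ∞ f x → ContDiffAt ℝ ∞ (fun q : ℝ × Coord => f q.2) (0, x) := fun hf =>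
    hf.comp ((0 : ℝ), x) contDiffAt_snd
  have hN : ∀ κ a, ContDiffAt ℝ ∞ (fun y => nablaSpinor g σ ξ y κ a) x := fun κ a =>
    (contDiffAt_nablaSpinor (gt := fun _ => g) (σt := fun _ => σ) (p := (0, x))
      (fun i j => hlift (hcg i j)) (fun α a b => hlift (hcσ α a b)) (fun a => hlift (hcξ a))
      hd κ a).comp x hι
  have hNb : ∀ κ a, ContDiffAt ℝ ∞ (fun y => nablaSpinorBar g σ ξ y κ a) x := fun κ a =>
    (contDiffAt_nablaSpinorBar (gt := fun _ => g) (σt := fun _ => σ) (p := (0, x))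
      (fun i j => hlift (hcg i j)) (fun α a b => hlift (hcσ α a b)) (fun a => hlift (hcξ a))
      hd κ a).comp x hι
  have hJ : ∀ κ γ, ContDiffAt ℝ ∞ (fun y => canonicalTensor g σ ξ y κ γ) x := fun κ γ =>
    ContDiffAt.sum fun a _ => ContDiffAt.sum fun b _ =>
      (((hcξ a).mul (hcσ γ a b)).mul (hNb κ b)).sub
        (((hN κ a).mul (hcσ γ a b)).mul (contDiffAt_conj (hcξ b)))
  simp only [energyMomentum_eq]
  refine ContinuousAt.continuousWithinAt (ContDiffAt.continuousAt (𝕜 := ℝ) (n := ∞) ?_)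
  exact (contDiffAt_const.mul (ContDiffAt.sum fun κ _ =>
    ((contDiffAt_ofReal (hinv μ κ)).mul (hJ κ ν)).add
      ((contDiffAt_ofReal (hinv ν κ)).mul (hJ κ μ)))).add
    ((contDiffAt_const.mul (ContDiffAt.sum fun κ _ => hJ κ κ)).mul (contDiffAt_ofReal (hinv μ ν)))

theorem isEnergyMomentumTensor_energyMomentum (hU : IsOpen U) (hbg : IsBackground U g σ ξ) :
    IsEnergyMomentumTensor U g σ ξ (energyMomentum g σ ξ) := by
  refine ⟨continuousOn_energyMomentum hU hbg, fun x hx μ ν => ?_, fun K r gt σt hv => ?_⟩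
  · rw [energyMomentum_eq, energyMomentum_eq, (hbg.lorentzian x hx).inv_apply_comm μ ν]
    simp only [add_comm]
  · obtain ⟨h1, h2⟩ := hasDerivAt_setIntegral_of_contDiffAt
      (f := fun q : ℝ × Coord => neutrinoDensity (gt q.1) (σt q.1) ξ q.2) hv.compact fun x hx =>
        (hv.contDiffAt_neutrinoDensity hU hbg (hv.subset hx)).of_le (WithTop.coe_le_coe.2 le_top)
    refine ⟨h1, (h2.const_mul (2 * Complex.I)).congr_deriv ?_⟩
    rw [← integral_const_mul]
    refine setIntegral_congr_fun hv.compact.measurableSet fun x hx => ?_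
    have hx' := hv.subset hx
    have hdiff : DifferentiableAt ℝ (fun t => neutrinoDensity (gt t) (σt t) ξ x) 0 :=
      (hasDerivAt_slice ((hv.contDiffAt_neutrinoDensity hU hbg hx').differentiableAt
        (by simp))).differentiableAt
    exact (hdiff.hasDerivAt.const_mul (2 * Complex.I)).unique
      (hv.hasDerivAt_neutrinoDensity hU hbg hx')

end EnergyMomentum

/-! ### Uniqueness of the energy-momentum tensor -/

section Uniqueness

variable {U : Set Coord} {g : MetricField} {σ : PauliField} {ξ : SpinorField}

/-- The straight line `g + t φ S` of metrics. -/
noncomputable def lineMetric (g : MetricField) (φ : Coord → ℝ) (S : Matrix (Fin 4) (Fin 4) ℝ)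
    (t : ℝ) : MetricField := fun x => g x + (t * φ x) • S

/-- The straight line `σ - (t/2) φ g⁻¹ S σ` of Pauli matrices that accompanies `lineMetric`. -/
noncomputable def linePauli (g : MetricField) (σ : PauliField) (φ : Coord → ℝ)
    (S : Matrix (Fin 4) (Fin 4) ℝ) (t : ℝ) : PauliField := fun x α =>
  Matrix.of fun a b => σ x α a b
    + (t : ℂ) * (-(1 / 2) * ∑ β, ∑ γ, (((g x)⁻¹ α β * (φ x * S β γ) : ℝ) : ℂ) * σ x γ a b)

theorem hasDerivAt_lineMetric (g : MetricField) (φ : Coord → ℝ) (S : Matrix (Fin 4) (Fin 4) ℝ)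
    (x : Coord) (i j : Fin 4) :
    HasDerivAt (fun t => lineMetric g φ S t x i j) (φ x * S i j) 0 := by
  have := (((hasDerivAt_id (0 : ℝ)).mul_const (φ x)).mul_const (S i j)).const_add (g x i j)
  simpa [lineMetric] using this

theorem deltaMetric_lineMetric (g : MetricField) (φ : Coord → ℝ) (S : Matrix (Fin 4) (Fin 4) ℝ)
    (x : Coord) (i j : Fin 4) : deltaMetric (lineMetric g φ S) x i j = φ x * S i j :=
  (hasDerivAt_lineMetric g φ S x i j).deriv

theorem isSymmVariation_line (hU : IsOpen U) (hbg : IsBackground U g σ ξ) {φ : Coord → ℝ}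
    (hφ : ContDiff ℝ ∞ φ) (hc : HasCompactSupport φ) (hs : tsupport φ ⊆ U)
    {S : Matrix (Fin 4) (Fin 4) ℝ} (hS : S.IsSymm) :
    IsSymmVariation U g σ (tsupport φ) 1 (lineMetric g φ S) (linePauli g σ φ S) where
  compact := hc
  subset := hs
  pos := one_pos
  smooth_metric i j := by
    rintro ⟨t, x⟩ ⟨-, hx⟩
    have h1 : ContDiffAt ℝ ∞ (fun q : ℝ × Coord => g q.2 i j) (t, x) :=
      ((hbg.smooth_metric i j).contDiffAt (hU.mem_nhds hx)).comp (t, x) contDiffAt_snd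
    have h2 : ContDiffAt ℝ ∞ (fun q : ℝ × Coord => φ q.2) (t, x) :=
      hφ.contDiffAt.comp (t, x) contDiffAt_snd
    exact (h1.add ((contDiffAt_fst.mul h2).mul contDiffAt_const)).contDiffWithinAt
  smooth_pauli α a b := by
    rintro ⟨t, x⟩ ⟨-, hx⟩
    have h1 : ∀ γ, ContDiffAt ℝ ∞ (fun q : ℝ × Coord => σ q.2 γ a b) (t, x) := fun γ =>
      ((hbg.smooth_pauli γ a b).contDiffAt (hU.mem_nhds hx)).comp (t, x) contDiffAt_snd
    have h2 : ContDiffAt ℝ ∞ (fun q : ℝ × Coord => φ q.2) (t, x) :=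
      hφ.contDiffAt.comp (t, x) contDiffAt_snd
    have h3 : ∀ β, ContDiffAt ℝ ∞ (fun q : ℝ × Coord => (g q.2)⁻¹ α β) (t, x) := fun β =>
      (contDiffAt_inv_apply (fun i j => (hbg.smooth_metric i j).contDiffAt (hU.mem_nhds hx))
        (hbg.lorentzian x hx).det_ne_zero α β).comp (t, x) contDiffAt_snd
    exact ((h1 α).add ((contDiffAt_ofReal contDiffAt_fst).mul (contDiffAt_const.mul
      (ContDiffAt.sum fun β _ => ContDiffAt.sum fun γ _ =>
        (contDiffAt_ofReal ((h3 β).mul (h2.mul contDiffAt_const))).mul (h1 γ))))).contDiffWithinAt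
  symm t _ x hx := (hbg.lorentzian x hx).1.add (hS.smul _)
  metric_zero x _ := by simp [lineMetric]
  pauli_zero x _ := by
    ext α a b
    simp [linePauli]
  metric_off t _ x hx := by simp [lineMetric, image_eq_zero_of_notMem_tsupport hx.2]
  pauli_off t _ x hx := by
    ext α a b
    simp [linePauli, image_eq_zero_of_notMem_tsupport hx.2]
  pauli_deriv x _ α a b := by
    simp only [deltaMetric_lineMetric]
    have := ((hasDerivAt_id (0 : ℝ)).ofReal_comp.mul_const
      (-(1 / 2) * ∑ β, ∑ γ, (((g x)⁻¹ α β * (φ x * S β γ) : ℝ) : ℂ) * σ x γ a b)).const_add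
      (σ x α a b)
    simp only [Complex.ofReal_one, one_mul] at this
    exact this

theorem continuousOn_volDensity (hbg : IsBackground U g σ ξ) : ContinuousOn (volDensity g) U := by
  have : ContinuousOn g U := continuousOn_pi.2 fun i => continuousOn_pi.2 fun j =>
    (hbg.smooth_metric i j).continuousOn
  exact (Continuous.matrix_det continuous_id).comp_continuousOn this |>.abs.sqrt

/-- Testing with the straight-line variations determines the tensor, by the fundamental lemma of
the calculus of variations. -/
theorem IsEnergyMomentumTensor.eqOn (hU : IsOpen U) (hbg : IsBackground U g σ ξ)
    {E E' : Coord → Fin 4 → Fin 4 → ℂ} (hE : IsEnergyMomentumTensor U g σ ξ E)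
    (hE' : IsEnergyMomentumTensor U g σ ξ E') {x : Coord} (hx : x ∈ U) (μ ν : Fin 4) :
    E x μ ν = E' x μ ν := by
  -- contraction with this matrix gives twice the component `μ ν` of a symmetric tensor
  set S : Matrix (Fin 4) (Fin 4) ℝ := Matrix.single μ ν 1 + Matrix.single ν μ 1 with hS
  have hSs : S.IsSymm := by
    rw [Matrix.IsSymm, hS, Matrix.transpose_add, Matrix.transpose_single, Matrix.transpose_single,
      add_comm]
  have hcontr : ∀ A : Coord → Fin 4 → Fin 4 → ℂ, ∀ y,
      ∑ i, ∑ j, A y i j * (S i j : ℂ) = A y μ ν + A y ν μ := fun A y => by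
    simp [hS, Matrix.single_apply, mul_add, Finset.sum_add_distrib, ite_and,
      apply_ite Complex.ofReal]
  set F : Coord → ℂ := fun y =>
    ((E y μ ν + E y ν μ) - (E' y μ ν + E' y ν μ)) * (volDensity g y : ℂ) with hF
  have hvol : ContinuousOn (fun y => (volDensity g y : ℂ)) U :=
    Complex.continuous_ofReal.comp_continuousOn (continuousOn_volDensity hbg)
  have hFc : ContinuousOn F U :=
    (((hE.1 μ ν).add (hE.1 ν μ)).sub ((hE'.1 μ ν).add (hE'.1 ν μ))).mul hvol
  have hzero : ∀ᵐ y, y ∈ U → F y = 0 := by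
    refine hU.ae_eq_zero_of_integral_contDiff_smul_eq_zero
      (hFc.locallyIntegrableOn hU.measurableSet) fun φ hφ hc hs => ?_
    have hv := isSymmVariation_line hU hbg hφ hc hs hSs
    have hi : ∀ A : Coord → Fin 4 → Fin 4 → ℂ, (∀ i j, ContinuousOn (fun y => A y i j) U) →
        IntegrableOn (fun y => (∑ i, ∑ j,
          A y i j * (deltaMetric (lineMetric g φ S) y i j : ℂ)) * (volDensity g y : ℂ))
          (tsupport φ) := fun A hA => by
      refine ContinuousOn.integrableOn_compact hc.isCompact ?_
      simp only [deltaMetric_lineMetric]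
      refine ContinuousOn.mono (ContinuousOn.mul (continuousOn_finsetSum _ fun i _ =>
        continuousOn_finsetSum _ fun j _ => (hA i j).mul (Continuous.continuousOn ?_)) hvol) hs
      exact Complex.continuous_ofReal.comp (hφ.continuous.mul continuous_const)
    have heq := ((hE.2.2 _ _ _ _ hv).2).unique ((hE'.2.2 _ _ _ _ hv).2)
    rw [← sub_eq_zero, ← integral_sub (hi E hE.1) (hi E' hE'.1)] at heq
    rw [← setIntegral_eq_integral_of_forall_compl_eq_zero (s := tsupport φ)
      fun y hy => by rw [image_eq_zero_of_notMem_tsupport hy, zero_smul], ← heq]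
    refine integral_congr_ae (Eventually.of_forall fun y => ?_)
    have h1 : ∀ A : Coord → Fin 4 → Fin 4 → ℂ, ∑ i, ∑ j,
        A y i j * (deltaMetric (lineMetric g φ S) y i j : ℂ)
          = φ y * (A y μ ν + A y ν μ) := fun A => by
      rw [← hcontr A y, Finset.mul_sum]
      simp only [deltaMetric_lineMetric, Finset.mul_sum]
      refine Finset.sum_congr rfl fun i _ => Finset.sum_congr rfl fun j _ => ?_
      push_cast
      ring
    simp only [h1, hF, Complex.real_smul]
    ring
  have hF0 : F x = 0 :=
    Measure.eqOn_open_of_ae_eq (μ := volume) (g := fun _ => (0 : ℂ))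
      ((ae_restrict_iff' hU.measurableSet).2 hzero) hU hFc continuousOn_const hx
  have hv0 : (volDensity g x : ℂ) ≠ 0 :=
    Complex.ofReal_ne_zero.2
      (Real.sqrt_pos.2 (abs_pos.2 (hbg.lorentzian x hx).det_ne_zero)).ne'
  have h2 := (mul_eq_zero.1 hF0).resolve_right hv0
  rw [hE.2.1 x hx ν μ, hE'.2.1 x hx ν μ, ← two_mul, ← two_mul, ← mul_sub] at h2
  exact sub_eq_zero.1 ((mul_eq_zero.1 h2).resolve_left two_ne_zero)

end Uniqueness

end Neutrino

theorem mainTheorem4 (U : Set Neutrino.Coord) (hU : IsOpen U)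
    (g : Neutrino.MetricField) (σ : Neutrino.PauliField) (ξ : Neutrino.SpinorField)
    (hbg : Neutrino.IsBackground U g σ ξ) :
    Neutrino.IsEnergyMomentumTensor U g σ ξ (Neutrino.energyMomentum g σ ξ) ∧
    (∀ E : Neutrino.Coord → Fin 4 → Fin 4 → ℂ,
      Neutrino.IsEnergyMomentumTensor U g σ ξ E →
        ∀ x ∈ U, ∀ μ ν, E x μ ν = Neutrino.energyMomentum g σ ξ x μ ν) ∧
    (∀ (K : Set Neutrino.Coord) (r : ℝ) (gt : ℝ → Neutrino.MetricField)
      (σt : ℝ → Neutrino.PauliField), Neutrino.IsSymmVariation U g σ K r gt σt →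
        (∀ x ∈ U, ∀ μ a,
          DifferentiableAt ℝ (fun t => Neutrino.nablaSpinor (gt t) (σt t) ξ x μ a) 0 ∧
          DifferentiableAt ℝ (fun t => Neutrino.nablaSpinorBar (gt t) (σt t) ξ x μ a) 0) ∧
        IntegrableOn (Neutrino.connectionDensity g σ ξ gt σt) K ∧
        2 * Complex.I * (∫ x in K, Neutrino.connectionDensity g σ ξ gt σt x) = 0) := by
  have hconn : ∀ (K : Set Neutrino.Coord) (r : ℝ) (gt : ℝ → Neutrino.MetricField)
      (σt : ℝ → Neutrino.PauliField), Neutrino.IsSymmVariation U g σ K r gt σt →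
      EqOn (Neutrino.connectionDensity g σ ξ gt σt) (fun _ => 0) K := fun K r gt σt hv x hx => by
    rw [Neutrino.connectionDensity, hv.weylForm_deltaNabla hU hbg (hv.subset hx), zero_mul]
  refine ⟨Neutrino.isEnergyMomentumTensor_energyMomentum hU hbg, fun E hE x hx μ ν =>
    hE.eqOn hU hbg (Neutrino.isEnergyMomentumTensor_energyMomentum hU hbg) hx μ ν,
    fun K r gt σt hv => ⟨fun x hx μ a =>
      ⟨(hv.hasDerivAt_nablaSpinor hU hbg hx μ a).differentiableAt,
        (hv.hasDerivAt_nablaSpinorBar hU hbg hx μ a).differentiableAt⟩, ?_, ?_⟩⟩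
  · exact (integrableOn_congr_fun (hconn K r gt σt hv) hv.compact.measurableSet).2 integrableOn_zero
  · rw [setIntegral_congr_fun hv.compact.measurableSet (hconn K r gt σt hv), integral_zero,
      mul_zero]
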